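/- **Theorem 4.11 (CD-lemma for Lie algebras over a field).** Let $k$ be a field and $X$ a well-ordered set. Order the free monoid $X^*$ by the lex ordering $\succ$ (with $1\succ v$ for every $v\ne 1$; otherwise first letters are compared, and if they agree the remaining words) and by the deg-lex ordering: $u>v$ iff $|u|>|v|$, or $|u|=|v|$ and $u\succ v$. For $0\ne f\in k\langle X\rangle$ let $\bar f$ be the deg-lex greatest word occurring in $f$; $f$ is monic if the coefficient of $\bar f$ is $1$. Let $Lie(X)\subset k\langle X\rangle$ be the Lie subalgebra generated by $X$ under $[f,g]=fg-gf$. A word $w\neq 1$ is an associative Lyndon–Shirshov word (ALSW) if $w>vu$ whenever $w=uv$ with $u,v\ne1$. A non-associative word $(w)$, with associative support $w$, is a non-associative Lyndon–Shirshov word (NLSW) if $w$ is an ALSW; whenever $(w)=((u)(v))$, both $(u)$ and $(v)$ are NLSWs; and whenever $(w)=(((u_1)(u_2))(v))$, $u_2\preceq v$. Every ALSW $w$ is the support of exactly one NLSW, denoted $[w]$, and brackets are evaluated in $Lie(X)$ as Lie brackets. If $w=aub$ and $u$ are ALSWs, then $[w]=[a[uc]d]$ with $b=cd$; writing $c=c_1\cdots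 c_n$ with ALSWs $c_1\preceq\cdots\preceq c_n$ ($n\ge 0$), the special bracketing $[aub]_u$ is obtained from $[w]$ by replacing $[uc]$ by $[\cdots[[u][c_1]]\cdots[c_n]]$. For a monic $s\in Lie(X)$ with $a\bar sb$ an ALSW, $[asb]_{\bar s}$ is obtained from $[a\bar sb]_{\bar s}$ by replacing $[\bar s]$ by $s$. Let $S\subset Lie(X)$ be a set of monic Lie polynomials. For $f,g\in S$ the compositions are: $f-[agb]_{\bar g}$ whenever $w=\bar f=a\bar gb$ with $a,b\in X^*$; and $[fb]_{\bar f}-[ag]_{\bar g}$ whenever $w=\bar fb=a\bar g$ with $a,b\in X^*$ and $|\bar f|+|\bar g|>|w|$. A normal $S$-word $(asb)$ is the value of a bracketing of $asb$ ($a,b\in X^*$, $s\in S$) with $\overline{(asb)}=a\bar sb$. The set $S$ is a Gröbner–Shirshov basis in $Lie(X)$ if every composition of elements of $S$ with respect to a word $w$ is a finite linear combination over $k$ of normal $S$-words $(a_is_ib_i)$ with $a_i\bar s_ib_i<w$. Let $Id(S)$ be the ideal of the Lie algebra $Lie(X)$ generated by $S$, and $Lie(X|S)=Lie(X)/Id(S)$.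 The following statements are equivalent: (i) $S$ is a Gröbner–Shirshov basis in $Lie(X)$. (ii) For every nonzero $f\in Id(S)$ there are $s\in S$ and $a,b\in X^*$ with $\bar f=a\bar sb$. (iii) The set $Irr(S)=\{[u]\ \text{an NLSW} : u\neq a\bar sb \text{ for all } s\in S,\ a,b\in X^*\}$ is a linear basis of $Lie(X|S)$; that is, the classes in $Lie(X|S)$ of the elements $[u]\in Irr(S)$, indexed by $Irr(S)$, are linearly independent and span $Lie(X|S)$. -/

import Mathlib

attribute [local instance 100] LieRing.ofAssociativeRing

namespace LieGS

/-! ### Words and their orderings -/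

section Words

variable {X : Type*} [LinearOrder X]

/-- The lex ordering `u ≺ v` on words: the empty word is greater than every non-empty word, and
otherwise first letters are compared first (so a proper prefix is greater than the word). -/
def LexLT : List X → List X → Prop
  | [], _ => False
  | _ :: _, [] => True
  | x :: u, y :: v => x < y ∨ (x = y ∧ LexLT u v)

/-- The deg-lex ordering `u < v` on words: first lengths are compared, then the lex ordering. -/
def DegLexLT (u v : FreeMonoid X) : Prop :=
  u.length < v.length ∨ (u.length = v.length ∧ LexLT u.toList v.toList)

/-- Associative Lyndon–Shirshov words: non-empty words that are greater than all their proper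
cyclic rotations. -/
def IsALSW (w : FreeMonoid X) : Prop :=
  w ≠ 1 ∧ ∀ u v : FreeMonoid X, u ≠ 1 → v ≠ 1 → w = u * v → DegLexLT (v * u) w

/-- The associative support of a non-associative word: the word left when brackets are erased. -/
def word : FreeMagma X → FreeMonoid X
  | .of x => FreeMonoid.of x
  | .mul t₁ t₂ => word t₁ * word t₂

/-- Non-associative Lyndon–Shirshov words: the support is an associative Lyndon–Shirshov word; if
`(w) = ((u)(v))` then `(u)` and `(v)` are non-associative Lyndon–Shirshov words; and if
`(w) = (((u₁)(u₂))(v))` then `u₂ ⪯ v` in the lex ordering. -/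
def IsNLSW : FreeMagma X → Prop
  | .of x => IsALSW (FreeMonoid.of x)
  | .mul t₁ t₂ => IsALSW (word t₁ * word t₂) ∧ IsNLSW t₁ ∧ IsNLSW t₂ ∧
      ∀ t₁₁ t₁₂ : FreeMagma X, t₁ = .mul t₁₁ t₁₂ →
        word t₁₂ = word t₂ ∨ LexLT (word t₁₂).toList (word t₂).toList

theorem LexLT.irrefl : ∀ u : List X, ¬ LexLT u u
  | [] => fun h => h
  | _ :: u => by
      rintro (h | ⟨-, h⟩)
      · exact lt_irrefl _ h
      · exact LexLT.irrefl u h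

theorem LexLT.trans : ∀ {u v w : List X}, LexLT u v → LexLT v w → LexLT u w
  | [], _, _, h, _ => h.elim
  | _ :: _, [], _, _, h => h.elim
  | _ :: _, _ :: _, [], _, _ => trivial
  | _ :: _, _ :: _, _ :: _, h₁, h₂ => by
      rcases h₁ with h₁ | ⟨rfl, h₁⟩
      · rcases h₂ with h₂ | ⟨rfl, h₂⟩
        · exact Or.inl (h₁.trans h₂)
        · exact Or.inl h₁
      · rcases h₂ with h₂ | ⟨rfl, h₂⟩
        · exact Or.inl h₂
        · exact Or.inr ⟨rfl, LexLT.trans h₁ h₂⟩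

theorem LexLT.trichotomy : ∀ u v : List X, LexLT u v ∨ u = v ∨ LexLT v u
  | [], [] => Or.inr (Or.inl rfl)
  | [], _ :: _ => Or.inr (Or.inr trivial)
  | _ :: _, [] => Or.inl trivial
  | x :: u, y :: v => by
      rcases lt_trichotomy x y with h | rfl | h
      · exact Or.inl (Or.inl h)
      · rcases LexLT.trichotomy u v with h | rfl | h
        · exact Or.inl (Or.inr ⟨rfl, h⟩)
        · exact Or.inr (Or.inl rfl)
        · exact Or.inr (Or.inr (Or.inr ⟨rfl, h⟩))
      · exact Or.inr (Or.inr (Or.inl h))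

theorem DegLexLT.irrefl (u : FreeMonoid X) : ¬ DegLexLT u u := by
  rintro (h | ⟨-, h⟩)
  · exact lt_irrefl _ h
  · exact LexLT.irrefl _ h

theorem DegLexLT.trans {u v w : FreeMonoid X} (h₁ : DegLexLT u v) (h₂ : DegLexLT v w) :
    DegLexLT u w := by
  rcases h₁ with h₁ | ⟨e₁, h₁⟩ <;> rcases h₂ with h₂ | ⟨e₂, h₂⟩
  · exact Or.inl (h₁.trans h₂)
  · exact Or.inl (e₂ ▸ h₁)
  · exact Or.inl (e₁ ▸ h₂)
  · exact Or.inr ⟨e₁.trans e₂, h₁.trans h₂⟩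

theorem DegLexLT.trichotomy (u v : FreeMonoid X) : DegLexLT u v ∨ u = v ∨ DegLexLT v u := by
  rcases lt_trichotomy u.length v.length with h | h | h
  · exact Or.inl (Or.inl h)
  · rcases LexLT.trichotomy u.toList v.toList with h' | h' | h'
    · exact Or.inl (Or.inr ⟨h, h'⟩)
    · exact Or.inr (Or.inl (FreeMonoid.toList.injective h'))
    · exact Or.inr (Or.inr (Or.inr ⟨h.symm, h'⟩))
  · exact Or.inr (Or.inr (Or.inl h))

end Words

/-! ### Non-associative words with one hole -/

/-- Non-associative words in `X` and one extra symbol (the hole), in which the hole occurs exactly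
once. -/
inductive Ctx (X : Type*)
  /-- the hole itself -/
  | hole : Ctx X
  /-- `((c)(t))` with the hole in `c` -/
  | mulRight : Ctx X → FreeMagma X → Ctx X
  /-- `((t)(c))` with the hole in `c` -/
  | mulLeft : FreeMagma X → Ctx X → Ctx X

namespace Ctx

variable {X : Type*}

/-- The associative word `a` to the left of the hole. -/
def left : Ctx X → FreeMonoid X
  | hole => 1
  | mulRight c _ => c.left
  | mulLeft t c => word t * c.left

/-- The associative word `b` to the right of the hole. -/
def right : Ctx X → FreeMonoid X
  | hole => 1
  | mulRight c t => c.right * word t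
  | mulLeft _ c => c.right

/-- Insert a non-associative word into the hole. -/
def fill : Ctx X → FreeMagma X → FreeMagma X
  | hole, u => u
  | mulRight c t, u => .mul (c.fill u) t
  | mulLeft t c, u => .mul t (c.fill u)

/-- Insert a non-associative word with a hole into the hole. -/
def comp : Ctx X → Ctx X → Ctx X
  | hole, d => d
  | mulRight c t, d => mulRight (c.comp d) t
  | mulLeft t c, d => mulLeft t (c.comp d)

/-- The left-normed product `[…[[⬝ t₁] t₂] … tₙ]`, where `⬝` is the hole. -/
def leftNormed (ts : List (FreeMagma X)) : Ctx X := ts.foldl mulRight hole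

end Ctx

section SpecialBracketing

variable {X : Type*} [LinearOrder X]

/-- `D` is the Shirshov special bracketing of the word `a u b` relative to its subword `u`, with a
hole in the place of `[u]`. Namely, the Lyndon–Shirshov bracketing `[aub]` contains a bracketed
subword `[uc]` that starts with the subword `u`, so that `[aub] = [a[uc]d]`, `b = cd`; if
`c = c₁ ⋯ cₙ` with Lyndon–Shirshov words `c₁ ⪯ ⋯ ⪯ cₙ`, then `[uc]` is replaced by
`[…[[⬝][c₁]]…[cₙ]]`. -/
def IsSpecialBracketing (a u b : FreeMonoid X) (D : Ctx X) : Prop :=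
  ∃ (C : Ctx X) (t : FreeMagma X) (c : FreeMonoid X) (cs : List (FreeMagma X)),
    IsNLSW (C.fill t) ∧
    C.left = a ∧ word t = u * c ∧ b = c * C.right ∧
    (∀ r ∈ cs, IsNLSW r) ∧
    (cs.map word).prod = c ∧
    cs.Pairwise (fun r r' => word r = word r' ∨ LexLT (word r).toList (word r').toList) ∧
    D = C.comp (Ctx.leftNormed cs)

end SpecialBracketing

/-! ### Polynomials -/

noncomputable section Polynomials

variable {k X : Type*} [Field k] [LinearOrder X]

/-- `w` is the greatest word, in the deg-lex ordering, that occurs in the element `f` of the free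
associative algebra `k⟨X⟩` (the monoid algebra of the free monoid). -/
def IsLeadingWord (f : MonoidAlgebra k (FreeMonoid X)) (w : FreeMonoid X) : Prop :=
  f.coeff w ≠ 0 ∧ ∀ v, f.coeff v ≠ 0 → v = w ∨ DegLexLT v w

theorem exists_isLeadingWord {f : MonoidAlgebra k (FreeMonoid X)} (hf : f ≠ 0) :
    ∃ w, IsLeadingWord f w := by
  classical
  have key : ∀ s : Finset (FreeMonoid X), s.Nonempty →
      ∃ w ∈ s, ∀ v ∈ s, v = w ∨ DegLexLT v w := by
    intro s hs
    induction hs using Finset.Nonempty.cons_induction with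
    | singleton a => exact ⟨a, by simp, by simp⟩
    | cons a s ha hs ih =>
      obtain ⟨w, hw, h⟩ := ih
      rcases DegLexLT.trichotomy a w with h' | rfl | h'
      · refine ⟨w, by simp [hw], fun v hv => ?_⟩
        rcases Finset.mem_cons.1 hv with rfl | hv
        · exact Or.inr h'
        · exact h v hv
      · exact absurd hw ha
      · refine ⟨a, by simp, fun v hv => ?_⟩
        rcases Finset.mem_cons.1 hv with rfl | hv
        · exact Or.inl rfl
        · rcases h v hv with rfl | h''
          · exact Or.inr h'
          · exact Or.inr (h''.trans h')
  have hne : f.coeff.support.Nonempty := by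
    rw [Finsupp.support_nonempty_iff]
    intro h
    apply hf
    ext w
    simp [h]
  obtain ⟨w, hw, h⟩ := key _ hne
  exact ⟨w, by simpa using hw, fun v hv => h v (by simpa using hv)⟩

theorem IsLeadingWord.unique {f : MonoidAlgebra k (FreeMonoid X)} {v w : FreeMonoid X}
    (hv : IsLeadingWord f v) (hw : IsLeadingWord f w) : v = w := by
  rcases hw.2 v hv.1 with h | h
  · exact h
  · rcases hv.2 w hw.1 with h' | h'
    · exact h'.symm
    · exact absurd (h.trans h') (DegLexLT.irrefl _)

open Classical in
/-- The leading word of a polynomial `f ≠ 0` in the deg-lex ordering (and `1` for `f = 0`). -/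
def lead (f : MonoidAlgebra k (FreeMonoid X)) : FreeMonoid X :=
  if h : ∃ w, IsLeadingWord f w then h.choose else 1

theorem isLeadingWord_lead {f : MonoidAlgebra k (FreeMonoid X)} (hf : f ≠ 0) :
    IsLeadingWord f (lead f) := by
  have h := exists_isLeadingWord hf
  rw [lead, dif_pos h]
  exact h.choose_spec

/-- The leading coefficient is `1` (in particular the polynomial is not zero). -/
def IsMonic (f : MonoidAlgebra k (FreeMonoid X)) : Prop := f.coeff (lead f) = 1

end Polynomials

/-! ### Lie polynomials -/

noncomputable section LiePolynomials

/-- `Lie(X)`: the Lie subalgebra of `k⟨X⟩`, with the bracket `[f, g] = f g - g f`, that is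
generated by `X`. -/
def LieX (k X : Type*) [Field k] : LieSubalgebra k (MonoidAlgebra k (FreeMonoid X)) :=
  LieSubalgebra.lieSpan k (MonoidAlgebra k (FreeMonoid X))
    (Set.range fun x : X => MonoidAlgebra.of k (FreeMonoid X) (FreeMonoid.of x))

variable {k X : Type*} [Field k]

/-- The letter `x` as an element of `Lie(X)`. -/
def letter (x : X) : LieX k X :=
  ⟨MonoidAlgebra.of k (FreeMonoid X) (FreeMonoid.of x), LieSubalgebra.subset_lieSpan ⟨x, rfl⟩⟩

variable (k) in
/-- The value in `Lie(X)` of a non-associative word, brackets being read as Lie brackets. -/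
def monomial : FreeMagma X → LieX k X
  | .of x => letter x
  | .mul t₁ t₂ => ⁅monomial t₁, monomial t₂⁆

/-- The Lie polynomial `(asb)`: the value of a non-associative word with one hole when the Lie
polynomial `s` is put into the hole. -/
def Ctx.eval : Ctx X → LieX k X → LieX k X
  | .hole, s => s
  | .mulRight c t, s => ⁅c.eval s, monomial k t⁆
  | .mulLeft t c, s => ⁅monomial k t, c.eval s⁆

variable [LinearOrder X]

/-- The leading word of a Lie polynomial, as an associative polynomial. -/
abbrev leadLie (f : LieX k X) : FreeMonoid X := lead (f : MonoidAlgebra k (FreeMonoid X))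

/-- `(asb)`, bracketed by `C`, is a normal word: its leading word is `a s̄ b`. -/
def IsNormal (C : Ctx X) (s : LieX k X) : Prop :=
  IsLeadingWord (C.eval s : MonoidAlgebra k (FreeMonoid X)) (C.left * leadLie s * C.right)

/-- `h` is trivial modulo `(S, w)`: it is a linear combination of normal `S`-words `(asb)` with
`a s̄ b < w`. -/
def IsTrivialMod (S : Set (LieX k X)) (w : FreeMonoid X) (h : LieX k X) : Prop :=
  h ∈ Submodule.span k {p : LieX k X | ∃ s ∈ S, ∃ C : Ctx X, IsNormal C s ∧
    DegLexLT (C.left * leadLie s * C.right) w ∧ p = C.eval s}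

/-- `h` is an inclusion composition `f - [agb]_{ḡ}` of `f` and `g` with respect to
`w = f̄ = a ḡ b`. -/
def IsInclusionComposition (f g : LieX k X) (w : FreeMonoid X) (h : LieX k X) : Prop :=
  ∃ (a b : FreeMonoid X) (D : Ctx X), w = leadLie f ∧ w = a * leadLie g * b ∧
    IsSpecialBracketing a (leadLie g) b D ∧ h = f - D.eval g

/-- `h` is an intersection composition `[fb]_{f̄} - [ag]_{ḡ}` of `f` and `g` with respect to
`w = f̄ b = a ḡ`, where `deg f̄ + deg ḡ > deg w`. -/
def IsIntersectionComposition (f g : LieX k X) (w : FreeMonoid X) (h : LieX k X) : Prop :=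
  ∃ (a b : FreeMonoid X) (D E : Ctx X), w = leadLie f * b ∧ w = a * leadLie g ∧
    w.length < (leadLie f).length + (leadLie g).length ∧
    IsSpecialBracketing 1 (leadLie f) b D ∧ IsSpecialBracketing a (leadLie g) 1 E ∧
    h = D.eval f - E.eval g

/-- `S` is a Gröbner–Shirshov basis in `Lie(X)`: every composition of elements of `S` with respect
to a word `w` is trivial modulo `(S, w)`. -/
def IsGSBasis (S : Set (LieX k X)) : Prop :=
  ∀ f ∈ S, ∀ g ∈ S, ∀ (w : FreeMonoid X) (h : LieX k X),
    IsInclusionComposition f g w h ∨ IsIntersectionComposition f g w h → IsTrivialMod S w h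

/-- `Id(S)`: the ideal of the Lie algebra `Lie(X)` generated by `S`. -/
def lieIdeal (S : Set (LieX k X)) : LieIdeal k (LieX k X) :=
  LieSubmodule.lieSpan k (LieX k X) S

/-- The word `u` contains a subword `s̄` with `s ∈ S`. -/
def ContainsLead (S : Set (LieX k X)) (u : FreeMonoid X) : Prop :=
  ∃ s ∈ S, ∃ a b : FreeMonoid X, u = a * leadLie s * b

/-- `Irr(S)`: the non-associative Lyndon–Shirshov words `[u]` such that `u` contains no `s̄`. -/
def Irr (S : Set (LieX k X)) : Set (FreeMagma X) :=
  {t | IsNLSW t ∧ ¬ ContainsLead S (word t)}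

/-- The class of a non-associative word in `Lie(X|S) = Lie(X)/Id(S)`. -/
def monomialClass (S : Set (LieX k X)) (t : FreeMagma X) : LieX k X ⧸ lieIdeal S :=
  LieSubmodule.Quotient.mk (monomial k t)

end LiePolynomials

end LieGS

/-!
The equivalence is deduced from the Composition-Diamond lemma for the free associative algebra
`k⟨X⟩`, and the combinatorics of Lyndon–Shirshov words provides the passage between `Lie(X)` and
`k⟨X⟩`.

*Words.* A Lyndon–Shirshov word is lex greater than its proper suffixes (`isALSW_iff`); hence it has
no border, and overlapping Lyndon–Shirshov words `ap`, `pb` form a Lyndon–Shirshov word `apb`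
(`IsALSW.overlap`). The right factor of an NLSW is the lex greatest proper suffix of its support,
which gives existence and uniqueness of the bracketing `[w]`, and shows that a Lyndon–Shirshov
subword `u` of `w` is a prefix of a bracketed subword, so that special bracketings exist.

*Leading words.* If `uv` is a Lyndon–Shirshov word and `f`, `g` are monic with leading words `u`,
`v`, then `[f, g]` is monic with leading word `uv`, since `vu < uv`. Therefore `[w]` has the leading
word `w` and a special bracketing `[asb]` has the leading word `a s̄ b`
(`IsSpecialBracketing.monicAt_eval`). By the Jacobi identity the monomials `[w]` span `Lie(X)`
(`span_monomial_eq_top`), so leading words of Lie polynomials are Lyndon–Shirshov words.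

*From (i) to (ii).* A single monic Lie polynomial `s` is a Gröbner–Shirshov basis in `k⟨X⟩`, because
`s̄` has no border. Hence by the associative lemma (`IsAssocGSBasis.mem_assocSpanLE`) normal
`S`-words, and the differences `[asb] - asb`, are combinations of `a' s b'` with the expected bounds
on `a' s̄ b'`, even if their expansions contain greater terms that cancel. So Lie compositions and
associative compositions agree up to trivial terms, a Gröbner–Shirshov basis in `Lie(X)` is one in
`k⟨X⟩`, and the associative lemma applies to `Id(S)`, which lies in the associative ideal.

*The other implications* are reductions by well-founded induction on the leading word, which
subtract a multiple of a special bracketing `[asb]` or of some `[u]` in `Irr(S)`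
(`mem_of_forall_exists_monicAt`).
-/

namespace LieGS

/-! ### The two orderings of words -/

section FreeMonoid

variable {X : Type*}

theorem length_pos {u : FreeMonoid X} (h : u ≠ 1) : 0 < u.length :=
  Nat.pos_of_ne_zero fun h' => h (FreeMonoid.length_eq_zero.1 h')

theorem mul_ne_one_of_left {u : FreeMonoid X} (h : u ≠ 1) (v : FreeMonoid X) : u * v ≠ 1 := by
  have := length_pos h
  rw [Ne, ← FreeMonoid.length_eq_zero, FreeMonoid.length_mul]
  omega

theorem mul_ne_one_of_right (u : FreeMonoid X) {v : FreeMonoid X} (h : v ≠ 1) : u * v ≠ 1 := by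
  have := length_pos h
  rw [Ne, ← FreeMonoid.length_eq_zero, FreeMonoid.length_mul]
  omega

theorem mul_eq_mul_cases {a b c d : FreeMonoid X} (h : a * b = c * d) :
    (∃ e, c = a * e ∧ b = e * d) ∨ ∃ e, a = c * e ∧ d = e * b :=
  List.append_eq_append_iff.1 h

end FreeMonoid

section Orderings

variable {X : Type*} [LinearOrder X]

open Classical in
/-- The lex ordering of words as a linear order: `u < v` is `LexLT u v`. In this order a word is
smaller than its proper prefixes. -/
@[reducible] noncomputable def lexOrder : LinearOrder (FreeMonoid X) where
  le u v := u = v ∨ LexLT u.toList v.toList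
  lt u v := LexLT u.toList v.toList
  le_refl u := Or.inl rfl
  le_trans u v w := by
    rintro (rfl | h₁) (rfl | h₂)
    exacts [Or.inl rfl, Or.inr h₂, Or.inr h₁, Or.inr (h₁.trans h₂)]
  lt_iff_le_not_ge u v := by
    refine ⟨fun h => ⟨Or.inr h, ?_⟩, ?_⟩
    · rintro (rfl | h')
      exacts [LexLT.irrefl _ h, LexLT.irrefl _ (h.trans h')]
    · rintro ⟨rfl | h, h'⟩
      exacts [absurd (Or.inl rfl) h', h]
  le_antisymm u v := by
    rintro (rfl | h₁) (h | h₂)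
    exacts [rfl, rfl, h.symm, (LexLT.irrefl _ (h₁.trans h₂)).elim]
  le_total u v := by
    rcases LexLT.trichotomy u.toList v.toList with h | h | h
    exacts [Or.inl (Or.inr h), Or.inl (Or.inl (FreeMonoid.toList.injective h)), Or.inr (Or.inr h)]
  toDecidableLE := Classical.decRel _

attribute [local instance] lexOrder

theorem mul_lt_mul_left_iff_lex (a : FreeMonoid X) {u v : FreeMonoid X} :
    a * u < a * v ↔ u < v := by
  induction a using FreeMonoid.inductionOn' with
  | one => simp
  | of_mul x a ih =>
    rw [mul_assoc, mul_assoc]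
    refine Iff.trans ?_ ih
    change (x < x ∨ (x = x ∧ _)) ↔ _
    simp only [lt_irrefl, false_or, true_and]
    rfl

theorem mul_lt_self_lex (u : FreeMonoid X) {v : FreeMonoid X} (h : v ≠ 1) : u * v < u := by
  conv_rhs => rw [← mul_one u]
  rw [mul_lt_mul_left_iff_lex]
  cases v using FreeMonoid.casesOn with
  | one => exact absurd rfl h
  | of_mul x v => trivial

/-- If `u < v` in the lex ordering, then `v` is a prefix of `u` or the words differ in a letter, and
then their order does not change when they are continued. -/
theorem lex_lt_cases {u v : FreeMonoid X} (h : u < v) :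
    (∃ r, r ≠ 1 ∧ u = v * r) ∨ ∀ a b, u * a < v * b := by
  induction u using FreeMonoid.inductionOn' generalizing v with
  | one => exact h.elim
  | of_mul x u ih =>
    cases v using FreeMonoid.casesOn with
    | one => exact Or.inl ⟨_, mul_ne_one_of_left (FreeMonoid.of_ne_one x) u, (one_mul _).symm⟩
    | of_mul y v =>
      rcases (h : x < y ∨ (x = y ∧ u < v)) with h | ⟨rfl, h⟩
      · exact Or.inr fun a b => Or.inl h
      · rcases ih h with ⟨r, hr, rfl⟩ | h'
        · exact Or.inl ⟨r, hr, by rw [mul_assoc]⟩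
        · exact Or.inr fun a b => Or.inr ⟨rfl, h' a b⟩

theorem mul_lt_mul_of_length_le {u v : FreeMonoid X} (h : u < v) (hl : u.length ≤ v.length)
    (a b : FreeMonoid X) : u * a < v * b := by
  rcases lex_lt_cases h with ⟨r, hr, rfl⟩ | h'
  · have := length_pos hr
    rw [FreeMonoid.length_mul] at hl
    omega
  · exact h' a b

/-- The weak deg-lex ordering. -/
def DegLexLE (u v : FreeMonoid X) : Prop := u = v ∨ DegLexLT u v

theorem DegLexLE.refl (u : FreeMonoid X) : DegLexLE u u := Or.inl rfl

theorem DegLexLT.le {u v : FreeMonoid X} (h : DegLexLT u v) : DegLexLE u v := Or.inr h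

theorem DegLexLE.trans_lt {u v w : FreeMonoid X} (h₁ : DegLexLE u v) (h₂ : DegLexLT v w) :
    DegLexLT u w := by
  rcases h₁ with rfl | h₁
  exacts [h₂, h₁.trans h₂]

theorem DegLexLT.trans_le {u v w : FreeMonoid X} (h₁ : DegLexLT u v) (h₂ : DegLexLE v w) :
    DegLexLT u w := by
  rcases h₂ with rfl | h₂
  exacts [h₁, h₁.trans h₂]

theorem DegLexLE.trans {u v w : FreeMonoid X} (h₁ : DegLexLE u v) (h₂ : DegLexLE v w) :
    DegLexLE u w := by
  rcases h₂ with rfl | h₂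
  exacts [h₁, (h₁.trans_lt h₂).le]

theorem degLexLT_or_le (u v : FreeMonoid X) : DegLexLT u v ∨ DegLexLE v u := by
  rcases DegLexLT.trichotomy u v with h | h | h
  exacts [Or.inl h, Or.inr (Or.inl h.symm), Or.inr h.le]

theorem DegLexLT.mul_left {u v : FreeMonoid X} (h : DegLexLT u v) (a : FreeMonoid X) :
    DegLexLT (a * u) (a * v) := by
  rcases h with h | ⟨hl, h⟩
  · exact Or.inl (by simpa using h)
  · exact Or.inr ⟨by simpa using hl, (mul_lt_mul_left_iff_lex a).2 h⟩

theorem DegLexLT.mul_right {u v : FreeMonoid X} (h : DegLexLT u v) (a : FreeMonoid X) :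
    DegLexLT (u * a) (v * a) := by
  rcases h with h | ⟨hl, h⟩
  · exact Or.inl (by simpa using h)
  · exact Or.inr ⟨by simpa using hl, mul_lt_mul_of_length_le h hl.le a a⟩

theorem DegLexLE.mul_left {u v : FreeMonoid X} (h : DegLexLE u v) (a : FreeMonoid X) :
    DegLexLE (a * u) (a * v) := by
  rcases h with rfl | h
  exacts [Or.inl rfl, (h.mul_left a).le]

theorem DegLexLE.mul_right {u v : FreeMonoid X} (h : DegLexLE u v) (a : FreeMonoid X) :
    DegLexLE (u * a) (v * a) := by
  rcases h with rfl | h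
  exacts [Or.inl rfl, (h.mul_right a).le]

theorem DegLexLT.wellFounded [WellFoundedLT X] :
    WellFounded (DegLexLT : FreeMonoid X → FreeMonoid X → Prop) := by
  have lex : ∀ u v : List X, u.length = v.length → LexLT u v → List.Lex (· < ·) u v := by
    intro u
    induction u with
    | nil => intro v _ h; exact h.elim
    | cons x u ih =>
      rintro (_ | ⟨y, v⟩) hl h
      · simp at hl
      · rcases h with h | ⟨rfl, h⟩
        · exact List.Lex.rel h
        · exact List.Lex.cons (ih v (by simpa using hl) h)
  refine Subrelation.wf (r := InvImage (List.Shortlex (· < ·)) FreeMonoid.toList) ?_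
    (InvImage.wf _ (List.Shortlex.wf wellFounded_lt))
  rintro u v (h | ⟨hl, h⟩)
  · exact List.Shortlex.of_length_lt h
  · exact List.Shortlex.of_lex hl (lex _ _ hl h)

end Orderings

/-! ### Associative Lyndon–Shirshov words -/

section Associative

variable {X : Type*} [LinearOrder X]

attribute [local instance] lexOrder

/-- An associative Lyndon–Shirshov word is a non-empty word that is lex greater than its proper
non-empty suffixes. -/
theorem isALSW_iff {w : FreeMonoid X} :
    IsALSW w ↔ w ≠ 1 ∧ ∀ u v : FreeMonoid X, u ≠ 1 → v ≠ 1 → w = u * v → v < w := by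
  refine and_congr_right fun hw => ⟨fun h u v hu hv e => ?_, fun h u v hu hv e => ?_⟩
  · have rot : ∀ u v : FreeMonoid X, u ≠ 1 → v ≠ 1 → w = u * v → v * u < w := by
      intro u v hu hv e
      rcases h u v hu hv e with h' | h'
      · rw [e, FreeMonoid.length_mul, FreeMonoid.length_mul] at h'
        omega
      · exact h'.2
    have hlu := length_pos hu
    have hl : w.length = u.length + v.length := by rw [e, FreeMonoid.length_mul]
    rcases lt_trichotomy v w with h' | rfl | h'
    · exact h'
    · omega
    · rcases lex_lt_cases h' with ⟨r, hr, e'⟩ | h'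
      · -- Here `u v = v r` with `|u| = |r|`, and the two rotations `v u` and `r v` contradict each
        -- other.
        have hlr : w.length = v.length + r.length := by rw [e', FreeMonoid.length_mul]
        have h₁ : u < r := by
          rw [← mul_lt_mul_left_iff_lex v, ← e']
          exact rot u v hu hv e
        have h₂ : u * v < r * v := mul_lt_mul_of_length_le h₁ (by omega) v v
        rw [← e] at h₂
        exact absurd (rot v r hv hr e') h₂.not_gt
      · have := h' 1 u
        rw [mul_one] at this
        exact absurd (rot u v hu hv e) this.not_gt
  · have hlu := length_pos hu
    have hl : w.length = u.length + v.length := by rw [e, FreeMonoid.length_mul]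
    refine Or.inr ⟨by rw [FreeMonoid.length_mul, hl, add_comm], ?_⟩
    have := mul_lt_mul_of_length_le (h u v hu hv e) (by omega) u 1
    rwa [mul_one] at this

theorem IsALSW.suffix_lt {u v : FreeMonoid X} (h : IsALSW (u * v)) (hu : u ≠ 1) (hv : v ≠ 1) :
    v < u * v :=
  (isALSW_iff.1 h).2 u v hu hv rfl

theorem isALSW_of (x : X) : IsALSW (FreeMonoid.of x) := by
  refine ⟨FreeMonoid.of_ne_one x, fun u v hu hv e => ?_⟩
  have h₁ := length_pos hu
  have h₂ := length_pos hv
  have := congrArg FreeMonoid.length e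
  rw [FreeMonoid.length_of, FreeMonoid.length_mul] at this
  omega

/-- Two overlapping Lyndon–Shirshov words `ap` and `pb` form a Lyndon–Shirshov word `apb`. -/
theorem IsALSW.overlap {a p b : FreeMonoid X} (hp : p ≠ 1) (h₁ : IsALSW (a * p))
    (h₂ : IsALSW (p * b)) : IsALSW (a * (p * b)) := by
  have hlt : a ≠ 1 → p * b < a * (p * b) := by
    intro ha
    rw [← mul_assoc]
    exact mul_lt_mul_of_length_le (h₁.suffix_lt ha hp) (by simp) b b
  refine isALSW_iff.2 ⟨mul_ne_one_of_right a (mul_ne_one_of_left hp b), fun x y hx hy e => ?_⟩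
  rcases mul_eq_mul_cases e with ⟨c, rfl, e'⟩ | ⟨c, rfl, rfl⟩
  · rcases eq_or_ne c 1 with rfl | hc
    · rw [one_mul] at e'
      rw [← e']
      exact hlt (by simpa using hx)
    · have h' : y < p * b := by
        rw [e'] at h₂ ⊢
        exact h₂.suffix_lt hc hy
      rcases eq_or_ne a 1 with rfl | ha
      · simpa using h'
      · exact h'.trans (hlt ha)
  · rcases eq_or_ne c 1 with rfl | hc
    · rw [one_mul]
      exact hlt (by simpa using hx)
    · rw [mul_assoc] at h₁
      have := mul_lt_mul_of_length_le (h₁.suffix_lt hx (mul_ne_one_of_left hc p)) (by simp) b b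
      simpa only [mul_assoc] using this

theorem IsALSW.lt_mul {u v : FreeMonoid X} (hv : IsALSW v) (hu : u ≠ 1) (h : v < u) :
    v < u * v := by
  rcases lex_lt_cases h with ⟨r, hr, rfl⟩ | h'
  · rw [mul_lt_mul_left_iff_lex]
    exact hv.suffix_lt hu hr
  · simpa using h' 1 v

theorem IsALSW.mul {u v : FreeMonoid X} (hu : IsALSW u) (hv : IsALSW v) (h : v < u) :
    IsALSW (u * v) := by
  have hlt := hv.lt_mul hu.1 h
  refine isALSW_iff.2 ⟨mul_ne_one_of_left hu.1 v, fun x y hx hy e => ?_⟩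
  rcases mul_eq_mul_cases e with ⟨c, rfl, rfl⟩ | ⟨c, rfl, rfl⟩
  · rcases eq_or_ne c 1 with rfl | hc
    · simpa using hlt
    · exact (hv.suffix_lt hc hy).trans hlt
  · rcases eq_or_ne c 1 with rfl | hc
    · simpa using hlt
    · exact mul_lt_mul_of_length_le (hu.suffix_lt hx hc) (by simp) v v

/-- A Lyndon–Shirshov word has no border: no proper non-empty prefix of it is a suffix. -/
theorem IsALSW.eq_one_of_border {a p b : FreeMonoid X} (h : IsALSW (a * p)) (hp : p ≠ 1)
    (e : a * p = p * b) : a = 1 := by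
  by_contra ha
  have h₁ := h.suffix_lt ha hp
  rw [e] at h₁
  rcases eq_or_ne b 1 with rfl | hb
  · simp at h₁
  · exact h₁.not_gt (mul_lt_self_lex p hb)

theorem IsALSW.le_of_mul_le {q s : FreeMonoid X} (hs : IsALSW s) (hq : q ≠ 1) (h : q * s ≤ s) :
    q ≤ s := by
  by_contra! h'
  rcases lex_lt_cases h' with ⟨r, hr, e⟩ | h'
  · subst e
    exact (hs.suffix_lt hq hr).not_ge (by
      rw [← not_lt, ← mul_lt_mul_left_iff_lex q, not_lt]; exact h)
  · have := h' 1 s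
    rw [mul_one] at this
    exact this.not_ge h

/-- The lex greatest non-empty suffix of a word. -/
theorem exists_max_suffix {c : FreeMonoid X} (hc : c ≠ 1) :
    ∃ x y, c = x * y ∧ y ≠ 1 ∧ ∀ x' y', c = x' * y' → y' ≠ 1 → y' ≤ y := by
  induction c using FreeMonoid.inductionOn' with
  | one => exact absurd rfl hc
  | of_mul a c ih =>
    have split : ∀ x' y' : FreeMonoid X, FreeMonoid.of a * c = x' * y' →
        y' = FreeMonoid.of a * c ∨ ∃ x'', c = x'' * y' := by
      intro x' y' e
      cases x' using FreeMonoid.casesOn with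
      | one => left; simpa using e.symm
      | of_mul z x' =>
        right
        rw [mul_assoc] at e
        exact ⟨x', (List.cons.inj (show a :: c.toList = z :: (x' * y').toList from e)).2⟩
    rcases eq_or_ne c 1 with rfl | hc'
    · refine ⟨1, _, (one_mul _).symm, hc, fun x' y' e hy' => ?_⟩
      rcases split x' y' e with rfl | ⟨x'', e'⟩
      · exact le_rfl
      · refine absurd (FreeMonoid.length_eq_zero.1 ?_) hy'
        have := congrArg FreeMonoid.length e'
        simp only [FreeMonoid.length_mul, FreeMonoid.length_one] at this
        omega
    · obtain ⟨x, y, e, hy, hmax⟩ := ih hc'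
      rcases le_total y (FreeMonoid.of a * c) with h | h
      · refine ⟨1, _, (one_mul _).symm, hc, fun x' y' e hy' => ?_⟩
        rcases split x' y' e with rfl | ⟨x'', e'⟩
        exacts [le_rfl, (hmax _ _ e' hy').trans h]
      · refine ⟨FreeMonoid.of a * x, y, by rw [e, mul_assoc], hy, fun x' y' e hy' => ?_⟩
        rcases split x' y' e with rfl | ⟨x'', e'⟩
        exacts [h, hmax _ _ e' hy']

theorem isALSW_of_max_suffix {c x y : FreeMonoid X} (e : c = x * y) (hy : y ≠ 1)
    (hmax : ∀ x' y', c = x' * y' → y' ≠ 1 → y' ≤ y) : IsALSW y := by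
  refine isALSW_iff.2 ⟨hy, fun u v hu hv e' => ?_⟩
  refine lt_of_le_of_ne (hmax (x * u) v (by rw [e, e', mul_assoc]) hv) fun h => hu ?_
  have := congrArg FreeMonoid.length e'
  rw [FreeMonoid.length_mul, h] at this
  exact FreeMonoid.length_eq_zero.1 (by omega)

/-- The standard factorization of a Lyndon–Shirshov word `w` that is not a letter: `w = uv`, where
`v` is the lex greatest proper non-empty suffix of `w`. -/
theorem IsALSW.exists_standard_factorization {w : FreeMonoid X} (hw : IsALSW w)
    (hl : w.length ≠ 1) : ∃ u v : FreeMonoid X, w = u * v ∧ IsALSW u ∧ IsALSW v ∧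
      ∀ x y, x ≠ 1 → y ≠ 1 → w = x * y → y ≤ v := by
  cases w using FreeMonoid.casesOn with
  | one => exact absurd rfl hw.1
  | of_mul a c =>
    have hc : c ≠ 1 := by
      rintro rfl
      simp at hl
    obtain ⟨x, v, rfl, hv, hmax⟩ := exists_max_suffix hc
    have hmax' : ∀ x' y, x' ≠ 1 → y ≠ 1 → FreeMonoid.of a * (x * v) = x' * y → y ≤ v := by
      intro x' y hx' hy e
      cases x' using FreeMonoid.casesOn with
      | one => exact absurd rfl hx'
      | of_mul z x' =>
        rw [mul_assoc] at e
        exact hmax x' y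
          (List.cons.inj (show a :: (x * v).toList = z :: (x' * y).toList from e)).2 hy
    refine ⟨FreeMonoid.of a * x, v, by rw [mul_assoc], ?_, isALSW_of_max_suffix rfl hv hmax, hmax'⟩
    rw [← mul_assoc] at hw hmax'
    generalize hu : FreeMonoid.of a * x = u at hw hmax'
    refine isALSW_iff.2 ⟨?_, fun s p hs hp e => ?_⟩
    · rw [← hu]
      exact mul_ne_one_of_left (FreeMonoid.of_ne_one a) x
    · by_contra! hle
      have hlt : u < p := by
        refine lt_of_le_of_ne hle fun h => hs ?_
        have := congrArg FreeMonoid.length e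
        rw [FreeMonoid.length_mul, h] at this
        exact FreeMonoid.length_eq_zero.1 (by omega)
      have hpv : p * v < u * v := by
        rw [e, mul_assoc] at hw ⊢
        exact hw.suffix_lt hs (mul_ne_one_of_left hp v)
      rcases lex_lt_cases hlt with ⟨r, hr, e'⟩ | h
      · rw [e', mul_assoc, mul_lt_mul_left_iff_lex] at hpv
        exact hpv.not_ge (hmax' p (r * v) hp (mul_ne_one_of_left hr v) (by rw [e', mul_assoc]))
      · exact hpv.not_gt (h v v)

end Associative

/-! ### Non-associative Lyndon–Shirshov words and special bracketings -/

section Trees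

variable {X : Type*}

theorem word_ne_one : ∀ t : FreeMagma X, word t ≠ 1
  | .of x => FreeMonoid.of_ne_one x
  | .mul t₁ t₂ => mul_ne_one_of_left (word_ne_one t₁) (word t₂)

theorem Ctx.word_fill (t : FreeMagma X) :
    ∀ C : Ctx X, word (C.fill t) = C.left * word t * C.right
  | .hole => by simp [fill, left, right]
  | .mulRight C u => by
      change word (C.fill t) * word u = C.left * word t * (C.right * word u)
      simp only [word_fill t C, mul_assoc]
  | .mulLeft u C => by
      change word u * word (C.fill t) = word u * C.left * word t * C.right
      simp only [word_fill t C, mul_assoc]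

theorem Ctx.left_comp (D : Ctx X) : ∀ C : Ctx X, (C.comp D).left = C.left * D.left
  | .hole => (one_mul _).symm
  | .mulRight C _ => left_comp D C
  | .mulLeft u C => by
      change word u * (C.comp D).left = word u * C.left * D.left
      rw [left_comp D C, mul_assoc]

theorem Ctx.right_comp (D : Ctx X) : ∀ C : Ctx X, (C.comp D).right = D.right * C.right
  | .hole => (mul_one _).symm
  | .mulRight C u => by
      change (C.comp D).right * word u = D.right * (C.right * word u)
      rw [right_comp D C, mul_assoc]
  | .mulLeft _ C => right_comp D C

theorem Ctx.leftNormed_append (cs : List (FreeMagma X)) (c : FreeMagma X) :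
    leftNormed (cs ++ [c]) = (leftNormed cs).mulRight c := by
  simp [leftNormed]

theorem Ctx.left_leftNormed (cs : List (FreeMagma X)) : (leftNormed cs).left = 1 := by
  induction cs using List.reverseRecOn with
  | nil => rfl
  | append_singleton cs c ih => rw [leftNormed_append]; exact ih

theorem Ctx.right_leftNormed (cs : List (FreeMagma X)) :
    (leftNormed cs).right = (cs.map word).prod := by
  induction cs using List.reverseRecOn with
  | nil => rfl
  | append_singleton cs c ih =>
    rw [leftNormed_append, List.map_append, List.prod_append, ← ih]
    simp [right]

variable [LinearOrder X]

attribute [local instance] lexOrder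

theorem IsNLSW.isALSW : ∀ {t : FreeMagma X}, IsNLSW t → IsALSW (word t)
  | .of _, h => h
  | .mul _ _, h => h.1

/-- The right factor `v` of a non-associative Lyndon–Shirshov word `[[u][v]]` is the lex greatest
proper non-empty suffix of `uv`. -/
theorem IsNLSW.suffix_le_right {t₁ t₂ : FreeMagma X} (h : IsNLSW (.mul t₁ t₂)) {a p : FreeMonoid X}
    (e : word t₁ * word t₂ = a * p) (ha : a ≠ 1) (hp : p ≠ 1) : p ≤ word t₂ := by
  induction t₁ using FreeMagma.rec generalizing t₂ a p with
  | of x =>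
    rcases mul_eq_mul_cases e with ⟨c, -, e'⟩ | ⟨c, e', -⟩
    · rcases eq_or_ne c 1 with rfl | hc
      · rw [one_mul] at e'
        exact e'.ge
      · have := h.2.2.1.isALSW
        rw [e'] at this ⊢
        exact (this.suffix_lt hc hp).le
    · have h₁ := congrArg FreeMonoid.length e'
      have h₂ := length_pos ha
      rw [word, FreeMonoid.length_of, FreeMonoid.length_mul] at h₁
      obtain rfl : c = 1 := FreeMonoid.length_eq_zero.1 (by omega)
      rw [mul_one] at e'
      rw [e'] at e
      exact (mul_left_cancel e).ge
  | mul t₁₁ t₁₂ ih₁ ih₂ =>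
    rcases mul_eq_mul_cases e with ⟨c, -, e'⟩ | ⟨c, e', rfl⟩
    · rcases eq_or_ne c 1 with rfl | hc
      · rw [one_mul] at e'
        exact e'.ge
      · have := h.2.2.1.isALSW
        rw [e'] at this ⊢
        exact (this.suffix_lt hc hp).le
    · rcases eq_or_ne c 1 with rfl | hc
      · rw [one_mul]
      · exact ((mul_lt_self_lex c (word_ne_one t₂)).le.trans (ih₁ h.2.1 e' ha hc)).trans
          (h.2.2.2 t₁₁ t₁₂ rfl)

theorem IsNLSW.eq_of_word_eq {t t' : FreeMagma X} (h : IsNLSW t) (h' : IsNLSW t')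
    (e : word t = word t') : t = t' := by
  have two : ∀ u v : FreeMagma X, 2 ≤ (word (.mul u v)).length := fun u v => by
    have h₁ := length_pos (word_ne_one u)
    have h₂ := length_pos (word_ne_one v)
    rw [word, FreeMonoid.length_mul]
    omega
  induction t using FreeMagma.rec generalizing t' with
  | of x =>
    cases t' using FreeMagma.rec with
    | of y => rw [FreeMonoid.of_injective e]
    | mul t₁' t₂' =>
      have := two t₁' t₂'
      rw [← e, word, FreeMonoid.length_of] at this
      omega
  | mul t₁ t₂ ih₁ ih₂ =>
    cases t' using FreeMagma.rec with
    | of y =>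
      have := two t₁ t₂
      rw [e, word, FreeMonoid.length_of] at this
      omega
    | mul t₁' t₂' =>
      change word t₁ * word t₂ = word t₁' * word t₂' at e
      have e₂ : word t₂ = word t₂' :=
        le_antisymm (h'.suffix_le_right e.symm (word_ne_one _) (word_ne_one _))
          (h.suffix_le_right e (word_ne_one _) (word_ne_one _))
      rw [e₂] at e
      rw [ih₁ h.2.1 h'.2.1 (mul_right_cancel e), ih₂ h.2.2.1 h'.2.2.1 e₂]

theorem IsALSW.exists_isNLSW {w : FreeMonoid X} (hw : IsALSW w) : ∃ t, IsNLSW t ∧ word t = w := by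
  induction hn : w.length using Nat.strong_induction_on generalizing w with
  | _ n ih =>
    by_cases hl : w.length = 1
    · obtain ⟨x, rfl⟩ := FreeMonoid.length_eq_one.1 hl
      exact ⟨.of x, hw, rfl⟩
    · obtain ⟨u, v, rfl, hu, hv, hmax⟩ := hw.exists_standard_factorization hl
      have hlu := length_pos hu.1
      have hlv := length_pos hv.1
      rw [FreeMonoid.length_mul] at hn
      obtain ⟨t₁, h₁, rfl⟩ := ih u.length (by omega) hu rfl
      obtain ⟨t₂, h₂, rfl⟩ := ih v.length (by omega) hv rfl
      refine ⟨.mul t₁ t₂, ⟨hw, h₁, h₂, ?_⟩, rfl⟩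
      rintro t₁₁ t₁₂ rfl
      refine hv.le_of_mul_le (word_ne_one t₁₂) (hmax (word t₁₁) _ (word_ne_one _)
        (mul_ne_one_of_right _ hv.1) ?_)
      rw [← mul_assoc]
      rfl

/-- Every word is a product `c₁ ⋯ cₙ` of Lyndon–Shirshov words with `c₁ ⪯ ⋯ ⪯ cₙ`. -/
theorem exists_lyndon_factorization (c : FreeMonoid X) :
    ∃ cs : List (FreeMagma X), (∀ r ∈ cs, IsNLSW r) ∧ (cs.map word).prod = c ∧
      cs.Pairwise (fun r r' => word r ≤ word r') := by
  induction hn : c.length using Nat.strong_induction_on generalizing c with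
  | _ n ih =>
    rcases eq_or_ne c 1 with rfl | hc
    · exact ⟨[], by simp, rfl, List.Pairwise.nil⟩
    · obtain ⟨x, y, rfl, hy, hmax⟩ := exists_max_suffix hc
      have hyL := isALSW_of_max_suffix rfl hy hmax
      obtain ⟨t, ht, rfl⟩ := hyL.exists_isNLSW
      have hly := length_pos hy
      rw [FreeMonoid.length_mul] at hn
      obtain ⟨cs, hcs, rfl, hp⟩ := ih x.length (by omega) x rfl
      refine ⟨cs ++ [t], ?_, by simp, ?_⟩
      · intro r hr
        rcases List.mem_append.1 hr with hr | hr
        · exact hcs r hr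
        · rwa [List.mem_singleton.1 hr]
      · refine List.pairwise_append.2 ⟨hp, List.pairwise_singleton _ _, ?_⟩
        intro r hr t' ht'
        rw [List.mem_singleton.1 ht']
        rcases List.eq_nil_or_concat cs with rfl | ⟨cs', s, rfl⟩
        · simp at hr
        · have hs : word s ≤ word t := by
            refine hyL.le_of_mul_le (word_ne_one s) (hmax (cs'.map word).prod _ ?_
              (mul_ne_one_of_right _ hy))
            simp [mul_assoc]
          rw [List.concat_eq_append] at hr hp
          rcases List.mem_append.1 hr with hr | hr
          · exact ((List.pairwise_append.1 hp).2.2 r hr s (by simp)).trans hs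
          · rwa [List.mem_singleton.1 hr]

/-- If the Lyndon–Shirshov word `u` is a subword of the support of a non-associative
Lyndon–Shirshov word, then it is a prefix of a bracketed subword. -/
theorem IsNLSW.exists_ctx {t : FreeMagma X} (ht : IsNLSW t) {a u b : FreeMonoid X}
    (hu : IsALSW u) (e : word t = a * u * b) :
    ∃ (C : Ctx X) (r : FreeMagma X) (c : FreeMonoid X),
      t = C.fill r ∧ C.left = a ∧ word r = u * c ∧ b = c * C.right := by
  induction t using FreeMagma.rec generalizing a b with
  | of x =>
    have h₁ := congrArg FreeMonoid.length e
    have h₂ := length_pos hu.1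
    simp only [word, FreeMonoid.length_of, FreeMonoid.length_mul] at h₁
    obtain rfl : a = 1 := FreeMonoid.length_eq_zero.1 (by omega)
    exact ⟨.hole, .of x, b, rfl, rfl, by rw [e, one_mul], (mul_one _).symm⟩
  | mul t₁ t₂ ih₁ ih₂ =>
    rcases eq_or_ne a 1 with rfl | ha
    · exact ⟨.hole, .mul t₁ t₂, b, rfl, rfl, by rw [e, one_mul], (mul_one _).symm⟩
    change word t₁ * word t₂ = a * u * b at e
    rcases mul_eq_mul_cases e with ⟨d, e₁, e₂⟩ | ⟨d, e₁, rfl⟩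
    · -- The subword `u` lies in the right factor.
      have right : ∀ q, a = word t₁ * q → word t₂ = q * u * b → ∃ (C : Ctx X) (r : FreeMagma X)
          (c : FreeMonoid X), FreeMagma.mul t₁ t₂ = C.fill r ∧ C.left = a ∧ word r = u * c ∧
            b = c * C.right := by
        rintro q rfl e₃
        obtain ⟨C, r, c, rfl, hC, hr, hb⟩ := ih₂ ht.2.2.1 e₃
        exact ⟨.mulLeft t₁ C, r, c, rfl, by rw [Ctx.left, hC], hr, hb⟩
      rcases mul_eq_mul_cases e₁ with ⟨q, e₃, rfl⟩ | ⟨q, e₃, rfl⟩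
      · rcases eq_or_ne d 1 with rfl | hd
        · obtain ⟨C, r, c, rfl, hC, hr, hb⟩ := ih₁ (b := 1) ht.2.1 (by rw [e₃, mul_one, mul_one])
          refine ⟨.mulRight C t₂, r, c, rfl, hC, hr, ?_⟩
          rw [Ctx.right, ← mul_assoc, ← hb, one_mul, e₂, one_mul]
        rcases eq_or_ne q 1 with rfl | hq
        · exact right 1 (by rw [e₃, mul_one, mul_one]) (by rw [e₂, one_mul, one_mul])
        -- If `u = qd` met both factors, `qd` and the right factor `db` would overlap, and `qdb`
        -- would be a proper suffix greater than the right factor.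
        have h₂ := ht.2.2.1.isALSW
        rw [e₂] at h₂
        have h₃ := ht.suffix_le_right (a := a) (p := q * (d * b)) (by rw [e, mul_assoc, mul_assoc])
          ha (mul_ne_one_of_left hq _)
        rw [e₂] at h₃
        exact absurd ((hu.overlap hd h₂).suffix_lt hq (mul_ne_one_of_left hd b)) h₃.not_gt
      · exact right q e₃ e₂
    · obtain ⟨C, r, c, rfl, hC, hr, rfl⟩ := ih₁ ht.2.1 e₁
      exact ⟨.mulRight C t₂, r, c, rfl, hC, hr, mul_assoc _ _ _⟩

theorem exists_isSpecialBracketing {a u b : FreeMonoid X} (hu : IsALSW u)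
    (hw : IsALSW (a * u * b)) : ∃ D : Ctx X, IsSpecialBracketing a u b D := by
  obtain ⟨t, ht, hword⟩ := hw.exists_isNLSW
  obtain ⟨C, r, c, rfl, hC, hr, hb⟩ := ht.exists_ctx hu hword
  obtain ⟨cs, hcs, hprod, hp⟩ := exists_lyndon_factorization c
  exact ⟨_, C, r, c, cs, ht, hC, hr, hb, hcs, hprod, hp, rfl⟩

theorem IsSpecialBracketing.left_eq {a u b : FreeMonoid X} {D : Ctx X}
    (h : IsSpecialBracketing a u b D) : D.left = a := by
  obtain ⟨C, t, c, cs, -, hC, -, -, -, -, -, rfl⟩ := h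
  rw [Ctx.left_comp, Ctx.left_leftNormed, mul_one, hC]

theorem IsSpecialBracketing.right_eq {a u b : FreeMonoid X} {D : Ctx X}
    (h : IsSpecialBracketing a u b D) : D.right = b := by
  obtain ⟨C, t, c, cs, -, -, -, hb, -, hprod, -, rfl⟩ := h
  rw [Ctx.right_comp, Ctx.right_leftNormed, hprod, hb]

end Trees

/-! ### Leading words of products and brackets -/

section LeadingWords

open MonoidAlgebra (of)

variable {k X : Type*} [Field k]

variable (k) in
/-- The polynomials in which only words from `P` occur. -/
def supportedIn (P : Set (FreeMonoid X)) : Submodule k (MonoidAlgebra k (FreeMonoid X)) where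
  carrier := {f | ∀ v, f.coeff v ≠ 0 → v ∈ P}
  add_mem' {f g} hf hg v hv := by
    by_contra h
    have h₁ : f.coeff v = 0 := by_contra fun h' => h (hf v h')
    have h₂ : g.coeff v = 0 := by_contra fun h' => h (hg v h')
    exact hv (by simp [h₁, h₂])
  zero_mem' v hv := absurd rfl hv
  smul_mem' c f hf v hv := hf v fun h => hv (by simp [h])

theorem supportedIn_mono {P Q : Set (FreeMonoid X)} (h : P ⊆ Q) :
    supportedIn k P ≤ supportedIn k Q :=
  fun _ hf v hv => h (hf v hv)

theorem of_mem_supportedIn {P : Set (FreeMonoid X)} {v : FreeMonoid X} (h : v ∈ P) :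
    of k _ v ∈ supportedIn k P := by
  classical
  intro w hw
  rw [MonoidAlgebra.of_apply, MonoidAlgebra.coeff_single, Finsupp.single_apply] at hw
  split_ifs at hw with e
  exacts [e ▸ h, absurd rfl hw]

theorem mul_mem_supportedIn {P Q R : Set (FreeMonoid X)} {f g : MonoidAlgebra k (FreeMonoid X)}
    (hf : f ∈ supportedIn k P) (hg : g ∈ supportedIn k Q)
    (h : ∀ u ∈ P, ∀ v ∈ Q, u * v ∈ R) : f * g ∈ supportedIn k R := by
  classical
  intro w hw
  rw [MonoidAlgebra.coeff_mul] at hw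
  obtain ⟨u, hu, hu'⟩ := Finset.exists_ne_zero_of_sum_ne_zero hw
  obtain ⟨v, hv, hv'⟩ := Finset.exists_ne_zero_of_sum_ne_zero hu'
  dsimp only at hv'
  split_ifs at hv' with e
  · exact e ▸ h u (hf u (Finsupp.mem_support_iff.1 hu)) v (hg v (Finsupp.mem_support_iff.1 hv))
  · exact absurd rfl hv'

theorem supportedIn_eq_span (P : Set (FreeMonoid X)) :
    supportedIn k P = Submodule.span k (of k _ '' P) := by
  refine le_antisymm (fun f hf => ?_) (Submodule.span_le.2 ?_)
  · rw [← f.sum_coeff_single]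
    refine Submodule.sum_mem _ fun v hv => ?_
    have : MonoidAlgebra.single v (f.coeff v) = f.coeff v • of k _ v := by
      rw [MonoidAlgebra.of_apply, MonoidAlgebra.smul_single', mul_one]
    rw [this]
    exact Submodule.smul_mem _ _
      (Submodule.subset_span ⟨v, hf v (Finsupp.mem_support_iff.1 hv), rfl⟩)
  · rintro _ ⟨v, hv, rfl⟩
    exact of_mem_supportedIn hv

theorem Ctx.eval_comp (D : Ctx X) (s : LieX k X) :
    ∀ C : Ctx X, (C.comp D).eval s = C.eval (D.eval s)
  | .hole => rfl
  | .mulRight C u => by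
      change ⁅(C.comp D).eval s, _⁆ = ⁅C.eval (D.eval s), _⁆
      rw [eval_comp D s C]
  | .mulLeft u C => by
      change ⁅_, (C.comp D).eval s⁆ = ⁅_, C.eval (D.eval s)⁆
      rw [eval_comp D s C]

variable [LinearOrder X]

variable (k) in
/-- The polynomials whose words are deg-lex smaller than `w`. -/
abbrev wordsLT (w : FreeMonoid X) : Submodule k (MonoidAlgebra k (FreeMonoid X)) :=
  supportedIn k {v | DegLexLT v w}

variable (k) in
/-- The polynomials whose words are deg-lex at most `w`. -/
abbrev wordsLE (w : FreeMonoid X) : Submodule k (MonoidAlgebra k (FreeMonoid X)) :=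
  supportedIn k {v | DegLexLE v w}

/-- The polynomial `f` is monic with leading word `w`: it is the sum of `w` and of a combination of
smaller words. -/
def MonicAt (f : MonoidAlgebra k (FreeMonoid X)) (w : FreeMonoid X) : Prop :=
  f - of k _ w ∈ wordsLT k w

theorem monicAt_of (w : FreeMonoid X) : MonicAt (of k _ w) w := by
  rw [MonicAt, sub_self]
  exact zero_mem _

theorem MonicAt.mem_wordsLE {f : MonoidAlgebra k (FreeMonoid X)} {w : FreeMonoid X}
    (h : MonicAt f w) : f ∈ wordsLE k w := by
  rw [← sub_add_cancel f (of k _ w)]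
  exact add_mem (supportedIn_mono (fun _ h => h.le) h) (of_mem_supportedIn (DegLexLE.refl w))

theorem MonicAt.coeff {f : MonoidAlgebra k (FreeMonoid X)} {w : FreeMonoid X}
    (h : MonicAt f w) : f.coeff w = 1 := by
  have h₁ : (f - of k _ w).coeff w = 0 := by_contra fun h' => DegLexLT.irrefl w (h w h')
  have h₂ : (of k _ w : MonoidAlgebra k (FreeMonoid X)).coeff w = 1 := by
    rw [MonoidAlgebra.of_apply, MonoidAlgebra.coeff_single, Finsupp.single_eq_same]
  rw [MonoidAlgebra.coeff_sub, Finsupp.sub_apply, h₂] at h₁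
  exact sub_eq_zero.1 h₁

theorem MonicAt.isLeadingWord {f : MonoidAlgebra k (FreeMonoid X)} {w : FreeMonoid X}
    (h : MonicAt f w) : IsLeadingWord f w :=
  ⟨by rw [h.coeff]; exact one_ne_zero, h.mem_wordsLE⟩

theorem IsLeadingWord.ne_zero {f : MonoidAlgebra k (FreeMonoid X)} {w : FreeMonoid X}
    (h : IsLeadingWord f w) : f ≠ 0 := by
  rintro rfl
  exact h.1 rfl

theorem IsLeadingWord.lead_eq {f : MonoidAlgebra k (FreeMonoid X)} {w : FreeMonoid X}
    (h : IsLeadingWord f w) : lead f = w :=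
  (isLeadingWord_lead h.ne_zero).unique h

theorem mem_wordsLT_of_coeff_eq_zero {f : MonoidAlgebra k (FreeMonoid X)} {w : FreeMonoid X}
    (h : f ∈ wordsLE k w) (h₀ : f.coeff w = 0) : f ∈ wordsLT k w := by
  intro v hv
  rcases h v hv with rfl | h'
  exacts [absurd h₀ hv, h']

theorem IsMonic.monicAt {f : MonoidAlgebra k (FreeMonoid X)} (h : IsMonic f) :
    MonicAt f (lead f) := by
  have hf : f ≠ 0 := by
    rintro rfl
    exact zero_ne_one h
  refine mem_wordsLT_of_coeff_eq_zero
    (sub_mem (isLeadingWord_lead hf).2 (of_mem_supportedIn (DegLexLE.refl _))) ?_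
  rw [MonoidAlgebra.coeff_sub, Finsupp.sub_apply, show f.coeff (lead f) = 1 from h,
    (monicAt_of (lead f)).coeff, sub_self]

theorem MonicAt.sub_mem {f g : MonoidAlgebra k (FreeMonoid X)} {w : FreeMonoid X}
    (hf : MonicAt f w) (hg : MonicAt g w) : f - g ∈ wordsLT k w := by
  have := Submodule.sub_mem _ hf hg
  rwa [sub_sub_sub_cancel_right] at this

theorem MonicAt.mul {f g : MonoidAlgebra k (FreeMonoid X)} {u v : FreeMonoid X}
    (hf : MonicAt f u) (hg : MonicAt g v) : MonicAt (f * g) (u * v) := by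
  have e : f * g - of k _ (u * v) =
      (f - of k _ u) * g + of k _ u * (g - of k _ v) := by
    rw [map_mul, sub_mul, mul_sub]
    abel
  rw [MonicAt, e]
  refine add_mem (mul_mem_supportedIn hf hg.mem_wordsLE ?_)
    (mul_mem_supportedIn (of_mem_supportedIn (P := {u}) rfl) hg ?_)
  · intro a ha b hb
    exact (ha.mul_right b).trans_le (hb.mul_left u)
  · rintro a rfl b hb
    exact hb.mul_left a

theorem MonicAt.lie {f g : MonoidAlgebra k (FreeMonoid X)} {u v : FreeMonoid X}
    (hf : MonicAt f u) (hg : MonicAt g v) (h : DegLexLT (v * u) (u * v)) :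
    MonicAt ⁅f, g⁆ (u * v) := by
  rw [MonicAt, LieRing.of_associative_ring_bracket, sub_right_comm]
  exact Submodule.sub_mem _ (hf.mul hg)
    (supportedIn_mono (fun w hw => DegLexLE.trans_lt hw h) (hg.mul hf).mem_wordsLE)

theorem IsALSW.rotate_lt {u v : FreeMonoid X} (h : IsALSW (u * v)) (hu : u ≠ 1) (hv : v ≠ 1) :
    DegLexLT (v * u) (u * v) :=
  h.2 u v hu hv rfl

/-- The leading word of the Lie monomial `[w]` is `w`. -/
theorem IsNLSW.monicAt {t : FreeMagma X} (h : IsNLSW t) :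
    MonicAt (monomial k t : MonoidAlgebra k (FreeMonoid X)) (word t) := by
  induction t using FreeMagma.rec with
  | of x => exact monicAt_of _
  | mul t₁ t₂ ih₁ ih₂ =>
    exact (ih₁ h.2.1).lie (ih₂ h.2.2.1) (h.1.rotate_lt (word_ne_one _) (word_ne_one _))

/-- If the bracketed subword `t` of a Lyndon–Shirshov bracketing is replaced by a Lie polynomial
with the same leading word, then the leading word of the whole does not change. -/
theorem Ctx.monicAt_eval {C : Ctx X} {t : FreeMagma X} (h : IsNLSW (C.fill t)) {g : LieX k X}
    (hg : MonicAt (g : MonoidAlgebra k (FreeMonoid X)) (word t)) :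
    MonicAt (C.eval g : MonoidAlgebra k (FreeMonoid X)) (word (C.fill t)) := by
  induction C with
  | hole => exact hg
  | mulRight C r ih =>
    exact (ih h.2.1).lie h.2.2.1.monicAt (h.1.rotate_lt (word_ne_one _) (word_ne_one _))
  | mulLeft r C ih =>
    exact h.2.1.monicAt.lie (ih h.2.2.1) (h.1.rotate_lt (word_ne_one _) (word_ne_one _))

attribute [local instance] lexOrder

/-- The leading word of `[⋯[[s][c₁]]⋯[cₙ]]` is `u c₁ ⋯ cₙ`, where `u` is the leading word of `s`, if
every `cᵢ` is lex smaller than `u c₁ ⋯ cₙ`. -/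
theorem Ctx.monicAt_eval_leftNormed {cs : List (FreeMagma X)} {u : FreeMonoid X} {s : LieX k X}
    (hcs : ∀ r ∈ cs, IsNLSW r) (hlt : ∀ r ∈ cs, word r < u * (cs.map word).prod)
    (hs : MonicAt (s : MonoidAlgebra k (FreeMonoid X)) u) :
    MonicAt ((leftNormed cs).eval s : MonoidAlgebra k (FreeMonoid X))
      (u * (cs.map word).prod) := by
  have prefix_le : ∀ a b : FreeMonoid X, a * b ≤ a := fun a b => by
    rcases eq_or_ne b 1 with rfl | hb
    exacts [(mul_one a).le, (mul_lt_self_lex a hb).le]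
  induction cs using List.reverseRecOn with
  | nil =>
    rw [List.map_nil, List.prod_nil, mul_one]
    exact hs
  | append_singleton cs c ih =>
    have e : u * ((cs ++ [c]).map word).prod = u * (cs.map word).prod * word c := by
      simp [mul_assoc]
    rw [e] at hlt ⊢
    rw [leftNormed_append]
    refine (ih (fun r hr => hcs r (by simp [hr]))
      (fun r hr => (hlt r (by simp [hr])).trans_le (prefix_le _ _))).lie
      (hcs c (by simp)).monicAt (Or.inr ⟨by simp [add_comm], ?_⟩)
    have := mul_lt_mul_of_length_le (hlt c (by simp)) (by simp) (u * (cs.map word).prod) 1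
    rwa [mul_one] at this

/-- The special bracketing `[asb]` of a monic Lie polynomial `s` with leading word `u` is monic with
leading word `aub`. -/
theorem IsSpecialBracketing.monicAt_eval {a u b : FreeMonoid X} {D : Ctx X}
    (h : IsSpecialBracketing a u b D) (hu : u ≠ 1) {s : LieX k X}
    (hs : MonicAt (s : MonoidAlgebra k (FreeMonoid X)) u) :
    MonicAt (D.eval s : MonoidAlgebra k (FreeMonoid X)) (a * u * b) := by
  obtain ⟨C, t, c, cs, hN, hC, ht, hb, hcs, hprod, hp, rfl⟩ := h
  have htN : IsNLSW t := by
    clear hC hb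
    induction C with
    | hole => exact hN
    | mulRight C r ih => exact ih hN.2.1
    | mulLeft r C ih => exact ih hN.2.2.1
  have hw : a * u * b = word (C.fill t) := by
    rw [Ctx.word_fill, hC, ht, hb]
    simp only [mul_assoc]
  rw [hw, Ctx.eval_comp]
  refine Ctx.monicAt_eval hN ?_
  rw [ht, ← hprod]
  refine Ctx.monicAt_eval_leftNormed hcs (fun r hr => ?_) hs
  -- Each `cᵢ` is at most the last factor `cₙ`, which is a proper suffix of the word `u c₁ ⋯ cₙ`.
  rcases List.eq_nil_or_concat cs with rfl | ⟨cs', l, rfl⟩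
  · simp at hr
  · rw [List.concat_eq_append] at *
    have e : u * ((cs' ++ [l]).map word).prod = u * (cs'.map word).prod * word l := by
      simp [mul_assoc]
    have hl : word l < u * ((cs' ++ [l]).map word).prod := by
      have h' := htN.isALSW
      rw [ht, ← hprod, e] at h'
      rw [e]
      exact h'.suffix_lt (mul_ne_one_of_left hu _) (word_ne_one l)
    rcases List.mem_append.1 hr with hr | hr
    · have : word r ≤ word l := (List.pairwise_append.1 hp).2.2 r hr l (by simp)
      exact this.trans_lt hl
    · rwa [List.mem_singleton.1 hr]

end LeadingWords

/-! ### Lyndon–Shirshov monomials span the free Lie algebra -/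

section Spanning

variable {k X : Type*} [Field k] [LinearOrder X]

variable (k) in
/-- The span of the Lie monomials `[u]` with `u` a Lyndon–Shirshov word that is deg-lex at most
`w`. -/
noncomputable def nlswSpan (w : FreeMonoid X) : Submodule k (LieX k X) :=
  Submodule.span k (monomial k '' {t | IsNLSW t ∧ DegLexLE (word t) w})

theorem monomial_mem_nlswSpan {t : FreeMagma X} {w : FreeMonoid X} (h : IsNLSW t)
    (hw : DegLexLE (word t) w) : monomial k t ∈ nlswSpan k w :=
  Submodule.subset_span ⟨t, ⟨h, hw⟩, rfl⟩

theorem nlswSpan_mono {v w : FreeMonoid X} (h : DegLexLE v w) : nlswSpan k v ≤ nlswSpan k w :=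
  Submodule.span_mono (Set.image_mono fun _ ht => ⟨ht.1, ht.2.trans h⟩)

theorem lie_mem_of_mem_nlswSpan {w : FreeMonoid X} {x y : LieX k X} {N : Submodule k (LieX k X)}
    (h : ∀ t, IsNLSW t → DegLexLE (word t) w → ⁅x, monomial k t⁆ ∈ N)
    (hy : y ∈ nlswSpan k w) : ⁅x, y⁆ ∈ N := by
  have : nlswSpan k w ≤ N.comap (LieModule.toEnd k (LieX k X) (LieX k X) x) := by
    refine Submodule.span_le.2 ?_
    rintro _ ⟨t, ht, rfl⟩
    exact h t ht.1 ht.2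
  exact this hy

attribute [local instance] lexOrder

/-- The bracket of two Lyndon–Shirshov monomials `[a]`, `[b]` is a combination of Lyndon–Shirshov
monomials whose words are at most `max (ab) (ba)`. If `[[a][b]]` is not itself a Lyndon–Shirshov
bracketing, then `a = a₁a₂` with `b ≺ a₂`, and the Jacobi identity expresses it by brackets with
smaller `max (ab) (ba)` and by brackets `[[a₁][t]]` with `a₁t = ab`. -/
theorem lie_monomial_mem_nlswSpan [WellFoundedLT X] (w : FreeMonoid X) {a b : FreeMagma X}
    (ha : IsNLSW a) (hb : IsNLSW b) (hab : DegLexLE (word a * word b) w)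
    (hba : DegLexLE (word b * word a) w) : ⁅monomial k a, monomial k b⁆ ∈ nlswSpan k w := by
  induction w using (DegLexLT.wellFounded (X := X)).induction generalizing a b with
  | _ w ih =>
  have ih' : ∀ {a b : FreeMagma X}, IsNLSW a → IsNLSW b → DegLexLT (word a * word b) w →
      DegLexLT (word b * word a) w → ⁅monomial k a, monomial k b⁆ ∈ nlswSpan k w := by
    intro a b ha hb hab hba
    rcases degLexLT_or_le (word a * word b) (word b * word a) with h | h
    · exact nlswSpan_mono hba.le (ih _ hba ha hb h.le (DegLexLE.refl _))
    · exact nlswSpan_mono hab.le (ih _ hab ha hb (DegLexLE.refl _) h)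
  have key : ∀ a b : FreeMagma X, IsNLSW a → IsNLSW b → word b < word a →
      word a * word b = w → ⁅monomial k a, monomial k b⁆ ∈ nlswSpan k w := by
    intro a
    induction a using FreeMagma.rec with
    | of x =>
      intro b ha hb hlt hw
      refine monomial_mem_nlswSpan (t := .mul (.of x) b) ⟨ha.isALSW.mul hb.isALSW hlt, ha, hb, ?_⟩
        (Or.inl hw)
      rintro t₁₁ t₁₂ ⟨⟩
    | mul a₁ a₂ ih₁ _ =>
      intro b ha hb hlt hw
      have hW : IsALSW (word (.mul a₁ a₂) * word b) := ha.isALSW.mul hb.isALSW hlt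
      by_cases hle : word a₂ ≤ word b
      · refine monomial_mem_nlswSpan (t := .mul (.mul a₁ a₂) b) ⟨hW, ha, hb, ?_⟩ (Or.inl hw)
        rintro t₁₁ t₁₂ ⟨⟩
        exact hle
      · rw [not_le] at hle
        have h₁ := ha.2.1
        have h₂ := ha.2.2.1
        have e : word a₁ * (word a₂ * word b) = w := by
          rw [← hw, word, mul_assoc]
        have h₂₁ : word a₂ < word a₁ :=
          (ha.isALSW.suffix_lt (word_ne_one a₁) (word_ne_one a₂)).trans
            (mul_lt_self_lex _ (word_ne_one a₂))
        have hl₁ := length_pos (word_ne_one a₁)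
        have hl₂ := length_pos (word_ne_one a₂)
        have hwl : w.length = (word a₁).length + ((word a₂).length + (word b).length) := by
          rw [← e, FreeMonoid.length_mul, FreeMonoid.length_mul]
        -- The bracket `[[a₁][b]]` is a combination of `[t]` with `t ≤ a₁b`, and
        -- `a₁ba₂ < a₁a₂b`, `a₂a₁b < a₁a₂b`.
        have m₁ : ⁅monomial k a₁, monomial k b⁆ ∈ nlswSpan k (word a₁ * word b) :=
          ih _ (Or.inl (by rw [FreeMonoid.length_mul]; omega)) h₁ hb (DegLexLE.refl _)
            ((h₁.isALSW.mul hb.isALSW (hle.trans h₂₁)).rotate_lt (word_ne_one _)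
              (word_ne_one _)).le
        have m₁' : ⁅monomial k a₂, ⁅monomial k a₁, monomial k b⁆⁆ ∈ nlswSpan k w := by
          refine lie_mem_of_mem_nlswSpan (fun t ht hle' => ih' h₂ ht ?_ ?_) m₁
          · refine (hle'.mul_left _).trans_lt ?_
            rw [← e, ← mul_assoc, ← mul_assoc]
            exact (ha.isALSW.rotate_lt (word_ne_one _) (word_ne_one _)).mul_right _
          · refine (hle'.mul_right _).trans_lt ?_
            rw [← e, mul_assoc]
            exact ((h₂.isALSW.mul hb.isALSW hle).rotate_lt (word_ne_one _)
              (word_ne_one _)).mul_left _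
        -- The bracket `[[a₂][b]]` is a combination of `[t]` with `t ≤ a₂b`; only `t = a₂b` does not
        -- make the product smaller.
        have m₂ : ⁅monomial k a₂, monomial k b⁆ ∈ nlswSpan k (word a₂ * word b) :=
          ih _ (Or.inl (by rw [FreeMonoid.length_mul]; omega)) h₂ hb (DegLexLE.refl _)
            ((h₂.isALSW.mul hb.isALSW hle).rotate_lt (word_ne_one _) (word_ne_one _)).le
        have m₂' : ⁅monomial k a₁, ⁅monomial k a₂, monomial k b⁆⁆ ∈ nlswSpan k w := by
          refine lie_mem_of_mem_nlswSpan (fun t ht hle' => ?_) m₂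
          rcases hle' with heq | hlt'
          · exact ih₁ t h₁ ht (heq ▸ (mul_lt_self_lex _ (word_ne_one b)).trans h₂₁) (heq ▸ e)
          · refine ih' h₁ ht (e ▸ hlt'.mul_left _) ((hlt'.mul_right _).trans ?_)
            rw [← e]
            refine IsALSW.rotate_lt ?_ (word_ne_one _) (mul_ne_one_of_left (word_ne_one _) _)
            rwa [← mul_assoc]
        change ⁅⁅monomial k a₁, monomial k a₂⁆, monomial k b⁆ ∈ _
        rw [lie_lie]
        exact sub_mem m₂' m₁'
  rcases lt_trichotomy (word a) (word b) with h | h | h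
  · rw [← lie_skew]
    refine neg_mem ?_
    rcases hba with hba | hba
    · exact key b a hb ha h hba
    · exact ih' hb ha hba
        (((hb.isALSW.mul ha.isALSW h).rotate_lt (word_ne_one _) (word_ne_one _)).trans hba)
  · rw [ha.eq_of_word_eq hb h, lie_self]
    exact zero_mem _
  · rcases hab with hab | hab
    · exact key a b ha hb h hab
    · exact ih' ha hb hab
        (((ha.isALSW.mul hb.isALSW h).rotate_lt (word_ne_one _) (word_ne_one _)).trans hab)

theorem span_monomial_eq_top [WellFoundedLT X] :
    Submodule.span k (monomial k '' {t : FreeMagma X | IsNLSW t}) = ⊤ := by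
  set V := Submodule.span k (monomial k '' {t : FreeMagma X | IsNLSW t}) with hV
  have hle : ∀ w : FreeMonoid X, nlswSpan k w ≤ V := fun w =>
    Submodule.span_mono (Set.image_mono fun t ht => ht.1)
  have closed : ∀ x y, x ∈ V → y ∈ V → ⁅x, y⁆ ∈ V := by
    intro x y hx hy
    induction hx, hy using Submodule.span_induction₂ with
    | mem_mem x y hx hy =>
      obtain ⟨a, ha, rfl⟩ := hx
      obtain ⟨b, hb, rfl⟩ := hy
      rcases degLexLT_or_le (word a * word b) (word b * word a) with h | h
      · exact hle _ (lie_monomial_mem_nlswSpan _ ha hb h.le (DegLexLE.refl _))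
      · exact hle _ (lie_monomial_mem_nlswSpan _ ha hb (DegLexLE.refl _) h)
    | zero_left y hy => rw [zero_lie]; exact zero_mem _
    | zero_right x hx => rw [lie_zero]; exact zero_mem _
    | add_left x y z hx hy hz h₁ h₂ => rw [add_lie]; exact add_mem h₁ h₂
    | add_right x y z hx hy hz h₁ h₂ => rw [lie_add]; exact add_mem h₁ h₂
    | smul_left r x y hx hy h => rw [smul_lie]; exact Submodule.smul_mem _ _ h
    | smul_right r x y hx hy h => rw [lie_smul]; exact Submodule.smul_mem _ _ h
  let K : LieSubalgebra k (MonoidAlgebra k (FreeMonoid X)) :=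
    { V.map ((LieX k X).incl : LieX k X →ₗ[k] MonoidAlgebra k (FreeMonoid X)) with
      lie_mem' := by
        rintro _ _ ⟨x, hx, rfl⟩ ⟨y, hy, rfl⟩
        exact ⟨⁅x, y⁆, closed x y hx hy, rfl⟩ }
  have hK : LieX k X ≤ K := by
    refine LieSubalgebra.lieSpan_le.2 ?_
    rintro _ ⟨x, rfl⟩
    exact ⟨letter x, Submodule.subset_span ⟨.of x, isALSW_of x, rfl⟩, rfl⟩
  refine eq_top_iff.2 fun x _ => ?_
  obtain ⟨y, hy, e⟩ := hK x.2
  rwa [← Subtype.ext e]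

theorem exists_max_degLex {ι : Type*} {s : Finset ι} (hs : s.Nonempty) (g : ι → FreeMonoid X) :
    ∃ i ∈ s, ∀ j ∈ s, DegLexLE (g j) (g i) := by
  induction hs using Finset.Nonempty.cons_induction with
  | singleton a => exact ⟨a, by simp, by simp [DegLexLE.refl]⟩
  | cons a s ha hs ih =>
    obtain ⟨i, hi, h⟩ := ih
    rcases degLexLT_or_le (g a) (g i) with h' | h'
    · exact ⟨i, by simp [hi], Finset.forall_mem_cons ha _ |>.2 ⟨h'.le, h⟩⟩
    · exact ⟨a, by simp, Finset.forall_mem_cons ha _ |>.2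
        ⟨DegLexLE.refl _, fun j hj => (h j hj).trans h'⟩⟩

/-- The leading word of a non-trivial linear combination of Lyndon–Shirshov monomials is the word of
one of them. -/
theorem exists_isLeadingWord_linearCombination {c : FreeMagma X →₀ k} (hc : c ≠ 0)
    (hN : ∀ t ∈ c.support, IsNLSW t) :
    ∃ t ∈ c.support, IsLeadingWord
      (Finsupp.linearCombination k (monomial k) c : MonoidAlgebra k (FreeMonoid X)) (word t) := by
  obtain ⟨t, ht, hmax⟩ := exists_max_degLex (Finsupp.support_nonempty_iff.2 hc) word
  have e : ((Finsupp.linearCombination k (monomial k) c : LieX k X) :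
      MonoidAlgebra k (FreeMonoid X)) =
        ∑ r ∈ c.support, c r • (monomial k r : MonoidAlgebra k (FreeMonoid X)) := by
    rw [Finsupp.linearCombination_apply, Finsupp.sum]
    exact map_sum (LieX k X).toSubmodule.subtype _ _
  refine ⟨t, ht, ?_, ?_⟩
  · rw [e, MonoidAlgebra.coeff_sum, Finsupp.finsetSum_apply, Finset.sum_eq_single t]
    · rw [MonoidAlgebra.coeff_smul_apply, (hN t ht).monicAt.coeff, smul_eq_mul, mul_one]
      exact Finsupp.mem_support_iff.1 ht
    · intro r hr hne
      rw [MonoidAlgebra.coeff_smul_apply]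
      refine smul_eq_zero_of_right _ (by_contra fun h => ?_)
      have h₁ : DegLexLE (word t) (word r) := (hN r hr).monicAt.mem_wordsLE _ h
      rcases hmax r hr with h₂ | h₂
      · exact hne ((hN r hr).eq_of_word_eq (hN t ht) h₂)
      · exact DegLexLT.irrefl _ (h₂.trans_le h₁)
    · exact fun h => absurd ht h
  · change _ ∈ wordsLE k (word t)
    rw [e]
    exact Submodule.sum_mem _ fun r hr => Submodule.smul_mem _ _
      (supportedIn_mono (fun v hv => DegLexLE.trans hv (hmax r hr)) (hN r hr).monicAt.mem_wordsLE)

theorem isALSW_lead [WellFoundedLT X] {f : LieX k X} (hf : f ≠ 0) : IsALSW (leadLie f) := by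
  have hmem : f ∈ Submodule.span k (monomial k '' {t : FreeMagma X | IsNLSW t}) := by
    rw [span_monomial_eq_top]
    trivial
  obtain ⟨c, hc, rfl⟩ := (Finsupp.mem_span_image_iff_linearCombination k).1 hmem
  have hc₀ : c ≠ 0 := by
    rintro rfl
    exact hf (map_zero _)
  have hN : ∀ t ∈ c.support, IsNLSW t := fun t ht => (Finsupp.mem_supported _ _).1 hc ht
  obtain ⟨t, ht, h⟩ := exists_isLeadingWord_linearCombination hc₀ hN
  rw [leadLie, h.lead_eq]
  exact (hN t ht).isALSW

end Spanning

/-! ### The Composition-Diamond lemma for the free associative algebra -/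

section Associative

open MonoidAlgebra (of)

variable {k X : Type*} [Field k] [LinearOrder X]

/-- The span of the polynomials `a s b` with `s ∈ S` and with the word `a s̄ b` in `P`. -/
noncomputable def assocSpan (S : Set (MonoidAlgebra k (FreeMonoid X))) (P : Set (FreeMonoid X)) :
    Submodule k (MonoidAlgebra k (FreeMonoid X)) :=
  Submodule.span k {p | ∃ s ∈ S, ∃ a b : FreeMonoid X, a * lead s * b ∈ P ∧
    p = of k _ a * s * of k _ b}

/-- The span of the polynomials `a s b` with `s ∈ S` and `a s̄ b < w`. -/
noncomputable abbrev assocSpanLT (S : Set (MonoidAlgebra k (FreeMonoid X))) (w : FreeMonoid X) :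
    Submodule k (MonoidAlgebra k (FreeMonoid X)) :=
  assocSpan S {v | DegLexLT v w}

/-- The span of the polynomials `a s b` with `s ∈ S` and `a s̄ b ≤ w`. -/
noncomputable abbrev assocSpanLE (S : Set (MonoidAlgebra k (FreeMonoid X))) (w : FreeMonoid X) :
    Submodule k (MonoidAlgebra k (FreeMonoid X)) :=
  assocSpan S {v | DegLexLE v w}

/-- A monic Gröbner–Shirshov basis in the free associative algebra: the inclusion compositions
`f - agb` for `f̄ = aḡb` and the intersection compositions `fb - ag` for `f̄ = ap`, `ḡ = pb` with
`p ≠ 1` are combinations of polynomials `c s d` with `c s̄ d` smaller than `f̄`, respectively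
`apb`. -/
structure IsAssocGSBasis (S : Set (MonoidAlgebra k (FreeMonoid X))) : Prop where
  monic : ∀ s ∈ S, MonicAt s (lead s)
  inclusion : ∀ f ∈ S, ∀ g ∈ S, ∀ a b, lead f = a * lead g * b →
    f - of k _ a * g * of k _ b ∈ assocSpanLT S (lead f)
  intersection : ∀ f ∈ S, ∀ g ∈ S, ∀ a p b, p ≠ 1 → lead f = a * p → lead g = p * b →
    f * of k _ b - of k _ a * g ∈ assocSpanLT S (a * p * b)

variable {S : Set (MonoidAlgebra k (FreeMonoid X))} {P Q : Set (FreeMonoid X)}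

theorem mem_assocSpan {s : MonoidAlgebra k (FreeMonoid X)} (hs : s ∈ S) {a b : FreeMonoid X}
    (h : a * lead s * b ∈ P) : of k _ a * s * of k _ b ∈ assocSpan S P :=
  Submodule.subset_span ⟨s, hs, a, b, h, rfl⟩

theorem assocSpan_mono {T : Set (MonoidAlgebra k (FreeMonoid X))} (hST : S ⊆ T) (h : P ⊆ Q) :
    assocSpan S P ≤ assocSpan T Q :=
  Submodule.span_mono fun _ ⟨s, hs, a, b, hab, e⟩ => ⟨s, hST hs, a, b, h hab, e⟩

theorem mul_mem_assocSpan {f : MonoidAlgebra k (FreeMonoid X)} (hf : f ∈ assocSpan S P)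
    (c d : FreeMonoid X) (h : ∀ v ∈ P, c * v * d ∈ Q) :
    of k _ c * f * of k _ d ∈ assocSpan S Q := by
  induction hf using Submodule.span_induction with
  | mem x hx =>
    obtain ⟨s, hs, a, b, hab, rfl⟩ := hx
    have : of k _ c * (of k _ a * s * of k _ b) * of k _ d =
        of k _ (c * a) * s * of k _ (b * d) := by
      simp only [map_mul, mul_assoc]
    rw [this]
    refine mem_assocSpan hs ?_
    have := h _ hab
    simpa only [mul_assoc] using this
  | zero => simp
  | add x y _ _ hx hy => rw [mul_add, add_mul]; exact add_mem hx hy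
  | smul r x _ hx => rw [mul_smul_comm, smul_mul_assoc]; exact Submodule.smul_mem _ _ hx

theorem mul_mem_assocSpanLT {f : MonoidAlgebra k (FreeMonoid X)} {w : FreeMonoid X}
    (hf : f ∈ assocSpanLT S w) (c d : FreeMonoid X) :
    of k _ c * f * of k _ d ∈ assocSpanLT S (c * w * d) :=
  mul_mem_assocSpan hf c d fun _ hv => (DegLexLT.mul_left hv c).mul_right d

theorem mul_wordsLT_mem_assocSpanLT {s h : MonoidAlgebra k (FreeMonoid X)} (hs : s ∈ S)
    {v : FreeMonoid X} (hh : h ∈ wordsLT k v) : s * h ∈ assocSpanLT S (lead s * v) := by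
  rw [wordsLT, supportedIn_eq_span] at hh
  induction hh using Submodule.span_induction with
  | mem x hx =>
    obtain ⟨u, hu, rfl⟩ := hx
    have := mem_assocSpan (P := {u | DegLexLT u (lead s * v)}) hs (a := 1) (b := u)
      (by rw [one_mul]; exact DegLexLT.mul_left hu _)
    rwa [map_one, one_mul] at this
  | zero => simp
  | add x y _ _ hx hy => rw [mul_add]; exact add_mem hx hy
  | smul r x _ hx => rw [mul_smul_comm]; exact Submodule.smul_mem _ _ hx

theorem wordsLT_mul_mem_assocSpanLT {s h : MonoidAlgebra k (FreeMonoid X)} (hs : s ∈ S)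
    {v : FreeMonoid X} (hh : h ∈ wordsLT k v) : h * s ∈ assocSpanLT S (v * lead s) := by
  rw [wordsLT, supportedIn_eq_span] at hh
  induction hh using Submodule.span_induction with
  | mem x hx =>
    obtain ⟨u, hu, rfl⟩ := hx
    have := mem_assocSpan (P := {u | DegLexLT u (v * lead s)}) hs (a := u) (b := 1)
      (by rw [mul_one]; exact DegLexLT.mul_right hu _)
    rwa [map_one, mul_one] at this
  | zero => simp
  | add x y _ _ hx hy => rw [add_mul]; exact add_mem hx hy
  | smul r x _ hx => rw [smul_mul_assoc]; exact Submodule.smul_mem _ _ hx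

/-- Disjoint occurrences of leading words: `f r ḡ - f̄ r g = (f - f̄) r g - f r (g - ḡ)`. -/
theorem sub_mem_assocSpanLT_of_disjoint {f g : MonoidAlgebra k (FreeMonoid X)} (hf : f ∈ S)
    (hg : g ∈ S) (hmf : MonicAt f (lead f)) (hmg : MonicAt g (lead g)) (r : FreeMonoid X) :
    f * of k _ (r * lead g) - of k _ (lead f * r) * g ∈
      assocSpanLT S (lead f * r * lead g) := by
  have e : f * of k _ (r * lead g) - of k _ (lead f * r) * g =
      (f * of k _ r - of k _ (lead f * r)) * g -
        f * (of k _ r * g - of k _ (r * lead g)) := by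
    simp only [sub_mul, mul_sub, mul_assoc]
    abel
  rw [e]
  refine Submodule.sub_mem _
    (wordsLT_mul_mem_assocSpanLT hg (hmf.mul (monicAt_of (k := k) r))) ?_
  rw [mul_assoc]
  exact mul_wordsLT_mem_assocSpanLT hf ((monicAt_of (k := k) r).mul hmg)

/-- If the same word `f̄ b = e ḡ d` contains two leading words of elements of `S`, of which the
first is a prefix, then `f b` and `e g d` agree up to smaller terms. -/
theorem IsAssocGSBasis.sub_mem_of_prefix (hS : IsAssocGSBasis S)
    {f g : MonoidAlgebra k (FreeMonoid X)} (hf : f ∈ S) (hg : g ∈ S) {b e d : FreeMonoid X}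
    (h : lead f * b = e * lead g * d) :
    f * of k _ b - of k _ e * g * of k _ d ∈ assocSpanLT S (lead f * b) := by
  have extend : ∀ {p : MonoidAlgebra k (FreeMonoid X)} {w : FreeMonoid X} (d : FreeMonoid X),
      p ∈ assocSpanLT S w → p * of k _ d ∈ assocSpanLT S (w * d) := by
    intro p w d hp
    have := mul_mem_assocSpanLT hp 1 d
    rwa [map_one, one_mul, one_mul] at this
  rcases mul_eq_mul_cases h with ⟨q, h₁, rfl⟩ | ⟨q, h₁, rfl⟩
  · have disjoint : ∀ r, e = lead f * r → q = r * lead g →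
        f * of k _ (q * d) - of k _ e * g * of k _ d ∈ assocSpanLT S (lead f * (q * d)) := by
      rintro r rfl rfl
      have := extend d (sub_mem_assocSpanLT_of_disjoint hf hg (hS.monic f hf) (hS.monic g hg) r)
      simpa only [map_mul, sub_mul, mul_assoc] using this
    rcases mul_eq_mul_cases h₁ with ⟨p, h₂, h₃⟩ | ⟨r, h₂, h₃⟩
    · rcases eq_or_ne p 1 with rfl | hp
      · exact disjoint 1 (by rw [h₂, mul_one, mul_one]) (by rw [h₃, one_mul, one_mul])
      · have := extend d (hS.intersection f hf g hg e p q hp h₂ h₃)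
        rw [← h₂] at this
        simpa only [map_mul, sub_mul, mul_assoc] using this
    · exact disjoint r h₂ h₃
  · have := extend b (hS.inclusion f hf g hg e q h₁)
    simpa only [map_mul, sub_mul, mul_assoc] using this

theorem IsAssocGSBasis.sub_mem (hS : IsAssocGSBasis S)
    {f g : MonoidAlgebra k (FreeMonoid X)} (hf : f ∈ S) (hg : g ∈ S) {a b c d : FreeMonoid X}
    (h : a * lead f * b = c * lead g * d) :
    of k _ a * f * of k _ b - of k _ c * g * of k _ d ∈ assocSpanLT S (a * lead f * b) := by
  have extend : ∀ {p : MonoidAlgebra k (FreeMonoid X)} {w : FreeMonoid X} (a : FreeMonoid X),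
      p ∈ assocSpanLT S w → of k _ a * p ∈ assocSpanLT S (a * w) := by
    intro p w a hp
    have := mul_mem_assocSpanLT hp a 1
    rwa [map_one, mul_one, mul_one] at this
  rw [mul_assoc, mul_assoc] at h
  rcases mul_eq_mul_cases h with ⟨e, rfl, h₁⟩ | ⟨e, rfl, h₁⟩
  · have := extend a (hS.sub_mem_of_prefix hf hg (h₁.trans (mul_assoc _ _ _).symm))
    simpa only [map_mul, mul_sub, mul_assoc] using this
  · have := extend c (hS.sub_mem_of_prefix hg hf (h₁.trans (mul_assoc _ _ _).symm))
    rw [h₁, ← Submodule.neg_mem_iff] at this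
    simpa only [map_mul, mul_sub, mul_assoc, neg_sub] using this

theorem mem_assocSpanLE_of_mem_assocSpan {f : MonoidAlgebra k (FreeMonoid X)}
    (hf : f ∈ assocSpan S P) : f = 0 ∨ ∃ w ∈ P, f ∈ assocSpanLE S w := by
  induction hf using Submodule.span_induction with
  | mem x hx =>
    obtain ⟨s, hs, a, b, hab, rfl⟩ := hx
    exact Or.inr ⟨_, hab, mem_assocSpan hs (DegLexLE.refl _)⟩
  | zero => exact Or.inl rfl
  | add x y _ _ hx hy =>
    rcases hx with rfl | ⟨u, hu, hx⟩
    · rwa [zero_add]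
    · rcases hy with rfl | ⟨v, hv, hy⟩
      · rw [add_zero]
        exact Or.inr ⟨u, hu, hx⟩
      · rcases degLexLT_or_le u v with h | h
        · exact Or.inr ⟨v, hv, add_mem
            (assocSpan_mono subset_rfl (fun _ hw => DegLexLE.trans hw h.le) hx) hy⟩
        · exact Or.inr ⟨u, hu, add_mem hx
            (assocSpan_mono subset_rfl (fun _ hw => DegLexLE.trans hw h) hy)⟩
  | smul r x _ hx =>
    rcases hx with rfl | ⟨u, hu, hx⟩
    · rw [smul_zero]
      exact Or.inl rfl
    · exact Or.inr ⟨u, hu, Submodule.smul_mem _ _ hx⟩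

theorem monicAt_mul_mul {s : MonoidAlgebra k (FreeMonoid X)} (hs : MonicAt s (lead s))
    (a b : FreeMonoid X) : MonicAt (of k _ a * s * of k _ b) (a * lead s * b) :=
  ((monicAt_of a).mul hs).mul (monicAt_of b)

/-- If `w` does not occur in a combination of polynomials `a s b` with `a s̄ b ≤ w`, then it is a
combination of those with `a s̄ b < w`: all polynomials `a s b` with `a s̄ b = w` agree up to smaller
terms. -/
theorem IsAssocGSBasis.mem_assocSpanLT (hS : IsAssocGSBasis S)
    {f : MonoidAlgebra k (FreeMonoid X)} {w : FreeMonoid X} (hf : f ∈ assocSpanLE S w)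
    (h₀ : f.coeff w = 0) : f ∈ assocSpanLT S w := by
  by_cases hex : ∃ s ∈ S, ∃ a b : FreeMonoid X, a * lead s * b = w
  · obtain ⟨s, hs, a, b, rfl⟩ := hex
    suffices h : f - f.coeff (a * lead s * b) • (of k _ a * s * of k _ b) ∈
        assocSpanLT S (a * lead s * b) by
      rwa [h₀, zero_smul, sub_zero] at h
    clear h₀
    induction hf using Submodule.span_induction with
    | mem x hx =>
      obtain ⟨t, ht, c, d, h, rfl⟩ := hx
      have hm := monicAt_mul_mul (hS.monic t ht) c d
      rcases h with h | h
      · rw [h] at hm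
        rw [hm.coeff, one_smul, ← h]
        exact hS.sub_mem ht hs h
      · have : (of k _ c * t * of k _ d).coeff (a * lead s * b) = 0 := by
          by_contra h'
          exact DegLexLT.irrefl _ (DegLexLE.trans_lt (hm.mem_wordsLE _ h') h)
        rw [this, zero_smul, sub_zero]
        exact mem_assocSpan ht h
    | zero => simp
    | add x y _ _ hx hy =>
      rw [MonoidAlgebra.coeff_add, Finsupp.add_apply, add_smul, add_sub_add_comm]
      exact add_mem hx hy
    | smul r x _ hx =>
      rw [MonoidAlgebra.coeff_smul_apply, smul_eq_mul, mul_smul, ← smul_sub]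
      exact Submodule.smul_mem _ _ hx
  · refine Submodule.span_mono ?_ hf
    rintro _ ⟨s, hs, a, b, h, rfl⟩
    exact ⟨s, hs, a, b, h.resolve_left fun e => hex ⟨s, hs, a, b, e⟩, rfl⟩

/-- The Composition-Diamond lemma: a polynomial in the ideal generated by a Gröbner–Shirshov basis
`S` is a combination of polynomials `a s b` whose leading words do not exceed its words. -/
theorem IsAssocGSBasis.mem_assocSpanLE [WellFoundedLT X] (hS : IsAssocGSBasis S)
    {f : MonoidAlgebra k (FreeMonoid X)} (hf : f ∈ assocSpan S Set.univ) {v : FreeMonoid X}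
    (hv : f ∈ wordsLE k v) : f ∈ assocSpanLE S v := by
  have key : ∀ w, f ∈ assocSpanLE S w → f ∈ assocSpanLE S v := by
    intro w
    induction w using (DegLexLT.wellFounded (X := X)).induction with
    | _ w ih =>
      intro hw
      rcases degLexLT_or_le v w with h | h
      · have h₀ : f.coeff w = 0 := by
          by_contra h'
          exact DegLexLT.irrefl _ (DegLexLE.trans_lt (hv w h') h)
        rcases mem_assocSpanLE_of_mem_assocSpan (hS.mem_assocSpanLT hw h₀) with rfl | ⟨u, hu, h'⟩
        · exact zero_mem _
        · exact ih u hu h'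
      · exact assocSpan_mono subset_rfl (fun _ hu => DegLexLE.trans hu h) hw
  rcases mem_assocSpanLE_of_mem_assocSpan hf with rfl | ⟨w, -, h⟩
  · exact zero_mem _
  · exact key w h

theorem IsAssocGSBasis.mem_assocSpanLT_of_wordsLT [WellFoundedLT X] (hS : IsAssocGSBasis S)
    {f : MonoidAlgebra k (FreeMonoid X)} (hf : f ∈ assocSpan S Set.univ) {v : FreeMonoid X}
    (hv : f ∈ wordsLT k v) : f ∈ assocSpanLT S v :=
  hS.mem_assocSpanLT (hS.mem_assocSpanLE hf (supportedIn_mono (fun _ h => h.le) hv))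
    (by_contra fun h => DegLexLT.irrefl v (hv v h))

/-- The leading word of a non-zero polynomial in the ideal generated by a Gröbner–Shirshov basis
contains the leading word of an element of the basis. -/
theorem IsAssocGSBasis.exists_lead_eq [WellFoundedLT X] (hS : IsAssocGSBasis S)
    {f : MonoidAlgebra k (FreeMonoid X)} (hf : f ∈ assocSpan S Set.univ) (hf₀ : f ≠ 0) :
    ∃ s ∈ S, ∃ a b : FreeMonoid X, lead f = a * lead s * b := by
  by_contra! hno
  have hl := isLeadingWord_lead hf₀
  have hlt : assocSpanLE S (lead f) ≤ wordsLT k (lead f) := by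
    refine Submodule.span_le.2 ?_
    rintro _ ⟨s, hs, a, b, h, rfl⟩
    exact supportedIn_mono (fun v hv => DegLexLE.trans_lt hv
      (h.resolve_left fun e => hno s hs a b e.symm))
      (monicAt_mul_mul (hS.monic s hs) a b).mem_wordsLE
  exact DegLexLT.irrefl _ (hlt (hS.mem_assocSpanLE hf hl.2) _ hl.1)

end Associative

/-! ### Lie compositions and associative compositions -/

section Comparison

open MonoidAlgebra (of)

variable {k X : Type*} [Field k] [LinearOrder X]

/-- `Lie(X)` as a linear subspace of `k⟨X⟩`. -/
noncomputable abbrev toAssoc (k X : Type*) [Field k] :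
    LieX k X →ₗ[k] MonoidAlgebra k (FreeMonoid X) :=
  (LieX k X).toSubmodule.subtype

theorem lie_mem_assocSpan {S : Set (MonoidAlgebra k (FreeMonoid X))}
    {f : MonoidAlgebra k (FreeMonoid X)} (hf : f ∈ assocSpan S Set.univ)
    (g : MonoidAlgebra k (FreeMonoid X)) : ⁅g, f⁆ ∈ assocSpan S Set.univ := by
  induction g using MonoidAlgebra.induction_linear with
  | zero => rw [zero_lie]; exact zero_mem _
  | add x y hx hy => rw [add_lie]; exact add_mem hx hy
  | single m r =>
    have e : MonoidAlgebra.single m r = r • of k _ m := by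
      rw [MonoidAlgebra.of_apply, MonoidAlgebra.smul_single', mul_one]
    have h₁ := mul_mem_assocSpan (Q := Set.univ) hf m 1 fun _ _ => trivial
    have h₂ := mul_mem_assocSpan (Q := Set.univ) hf 1 m fun _ _ => trivial
    rw [map_one, mul_one] at h₁
    rw [map_one, one_mul] at h₂
    rw [e, LieRing.of_associative_ring_bracket, smul_mul_assoc, mul_smul_comm, ← smul_sub]
    exact Submodule.smul_mem _ _ (sub_mem h₁ h₂)

theorem Ctx.eval_mem_assocSpan {S : Set (MonoidAlgebra k (FreeMonoid X))} {s : LieX k X}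
    (hs : (s : MonoidAlgebra k (FreeMonoid X)) ∈ S) (C : Ctx X) :
    (C.eval s : MonoidAlgebra k (FreeMonoid X)) ∈ assocSpan S Set.univ := by
  induction C with
  | hole =>
    have := mem_assocSpan (P := Set.univ) hs (a := 1) (b := 1) trivial
    rwa [map_one, one_mul, mul_one] at this
  | mulRight C t ih =>
    change ⁅(C.eval s : MonoidAlgebra k (FreeMonoid X)), _⁆ ∈ _
    rw [← lie_skew]
    exact neg_mem (lie_mem_assocSpan ih _)
  | mulLeft t C ih => exact lie_mem_assocSpan ih _

/-- The leading word of a Lie polynomial has no border, so that a single monic Lie polynomial has no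
compositions except the trivial one. -/
theorem isAssocGSBasis_singleton {s : MonoidAlgebra k (FreeMonoid X)} (hs : MonicAt s (lead s))
    (hw : IsALSW (lead s)) : IsAssocGSBasis {s} where
  monic := by rintro _ rfl; exact hs
  inclusion := by
    rintro f rfl g rfl a b e
    have := congrArg FreeMonoid.length e
    rw [FreeMonoid.length_mul, FreeMonoid.length_mul] at this
    obtain rfl : a = 1 := FreeMonoid.length_eq_zero.1 (by omega)
    obtain rfl : b = 1 := FreeMonoid.length_eq_zero.1 (by omega)
    rw [map_one, one_mul, mul_one, sub_self]
    exact zero_mem _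
  intersection := by
    rintro f rfl g rfl a p b hp e₁ e₂
    obtain rfl : a = 1 := (e₁ ▸ hw).eq_one_of_border hp (e₁.symm.trans e₂)
    obtain rfl : b = 1 := by
      rw [e₁, one_mul] at e₂
      exact mul_eq_left.1 e₂.symm
    simp only [map_one, one_mul, mul_one, sub_self, zero_mem]

theorem mem_assocSpan_of_mem_lieIdeal {S : Set (LieX k X)} {f : LieX k X} (hf : f ∈ lieIdeal S) :
    (f : MonoidAlgebra k (FreeMonoid X)) ∈ assocSpan (toAssoc k X '' S) Set.univ := by
  let N : LieIdeal k (LieX k X) :=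
    { (assocSpan (toAssoc k X '' S) Set.univ).comap (toAssoc k X) with
      lie_mem := fun {x m} hm => lie_mem_assocSpan (g := (x : MonoidAlgebra k (FreeMonoid X))) hm }
  have : lieIdeal S ≤ N := LieSubmodule.lieSpan_le.2 fun s hs =>
    Ctx.eval_mem_assocSpan (Set.mem_image_of_mem (toAssoc k X) hs) .hole
  exact this hf

variable [WellFoundedLT X]

theorem IsMonic.isALSW {s : LieX k X} (hs : IsMonic (s : MonoidAlgebra k (FreeMonoid X))) :
    IsALSW (leadLie s) := by
  refine isALSW_lead fun h => ?_
  rw [h] at hs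
  exact hs.monicAt.isLeadingWord.ne_zero rfl

/-- The special bracketing `[asb]` and the associative product `a s b` differ by terms `a' s b'`
whose leading words are smaller than `a s̄ b`. -/
theorem IsSpecialBracketing.eval_sub_mem {S : Set (MonoidAlgebra k (FreeMonoid X))} {s : LieX k X}
    (hs : IsMonic (s : MonoidAlgebra k (FreeMonoid X)))
    (hsS : (s : MonoidAlgebra k (FreeMonoid X)) ∈ S) {a b : FreeMonoid X} {D : Ctx X}
    (hD : IsSpecialBracketing a (leadLie s) b D) :
    (D.eval s : MonoidAlgebra k (FreeMonoid X)) -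
      of k _ a * (s : MonoidAlgebra k (FreeMonoid X)) * of k _ b ∈
        assocSpanLT S (a * leadLie s * b) := by
  have h₁ : (D.eval s : MonoidAlgebra k (FreeMonoid X)) ∈
      assocSpan {(s : MonoidAlgebra k (FreeMonoid X))} Set.univ :=
    D.eval_mem_assocSpan (Set.mem_singleton _)
  have h₂ : of k _ a * (s : MonoidAlgebra k (FreeMonoid X)) * of k _ b ∈
      assocSpan {(s : MonoidAlgebra k (FreeMonoid X))} Set.univ :=
    mem_assocSpan (Set.mem_singleton _) trivial
  exact assocSpan_mono (Set.singleton_subset_iff.2 hsS) subset_rfl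
    ((isAssocGSBasis_singleton hs.monicAt hs.isALSW).mem_assocSpanLT_of_wordsLT
      (Submodule.sub_mem _ h₁ h₂)
      ((hD.monicAt_eval hs.isALSW.1 hs.monicAt).sub_mem (monicAt_mul_mul hs.monicAt a b)))

theorem IsTrivialMod.mem_assocSpanLT {S : Set (LieX k X)}
    (hS : ∀ s ∈ S, IsMonic (s : MonoidAlgebra k (FreeMonoid X))) {w : FreeMonoid X} {h : LieX k X}
    (hh : IsTrivialMod S w h) :
    (h : MonoidAlgebra k (FreeMonoid X)) ∈ assocSpanLT (toAssoc k X '' S) w := by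
  have hle : Submodule.span k {p : LieX k X | ∃ s ∈ S, ∃ C : Ctx X, IsNormal C s ∧
      DegLexLT (C.left * leadLie s * C.right) w ∧ p = C.eval s} ≤
        (assocSpanLT (toAssoc k X '' S) w).comap (toAssoc k X) := by
    refine Submodule.span_le.2 ?_
    rintro _ ⟨s, hs, C, hC, hlt, rfl⟩
    have hm := hS s hs
    have hsS : {(s : MonoidAlgebra k (FreeMonoid X))} ⊆ toAssoc k X '' S :=
      Set.singleton_subset_iff.2 ⟨s, hs, rfl⟩
    have hle : {v | DegLexLE v (C.left * leadLie s * C.right)} ⊆ {v | DegLexLT v w} :=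
      fun v hv => DegLexLE.trans_lt hv hlt
    have h₁ : (C.eval s : MonoidAlgebra k (FreeMonoid X)) ∈
        assocSpan {(s : MonoidAlgebra k (FreeMonoid X))} Set.univ :=
      C.eval_mem_assocSpan (Set.mem_singleton _)
    exact assocSpan_mono hsS hle
      ((isAssocGSBasis_singleton hm.monicAt hm.isALSW).mem_assocSpanLE h₁ hC.2)
  exact hle hh

/-- A Gröbner–Shirshov basis in `Lie(X)` is one in `k⟨X⟩`, as the Lie composition of two polynomials
differs from the associative one by trivial terms. -/
theorem IsGSBasis.isAssocGSBasis {S : Set (LieX k X)}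
    (hS : ∀ s ∈ S, IsMonic (s : MonoidAlgebra k (FreeMonoid X))) (h : IsGSBasis S) :
    IsAssocGSBasis (toAssoc k X '' S) where
  monic := by
    rintro _ ⟨s, hs, rfl⟩
    exact (hS s hs).monicAt
  inclusion := by
    rintro _ ⟨f, hf, rfl⟩ _ ⟨g, hg, rfl⟩ a b e
    change leadLie f = a * leadLie g * b at e
    have hw := (hS f hf).isALSW
    rw [e] at hw
    obtain ⟨D, hD⟩ := exists_isSpecialBracketing (hS g hg).isALSW hw
    have h₁ := (h f hf g hg _ _ (Or.inl ⟨a, b, D, rfl, e, hD, rfl⟩)).mem_assocSpanLT hS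
    have h₂ := hD.eval_sub_mem (hS g hg) (Set.mem_image_of_mem (toAssoc k X) hg)
    rw [← e] at h₂
    have h₃ := add_mem h₁ h₂
    change (f : MonoidAlgebra k (FreeMonoid X)) - D.eval g + _ ∈ _ at h₃
    rwa [sub_add_sub_cancel] at h₃
  intersection := by
    rintro _ ⟨f, hf, rfl⟩ _ ⟨g, hg, rfl⟩ a p b hp e₁ e₂
    change leadLie f = a * p at e₁
    change leadLie g = p * b at e₂
    have hf' := (hS f hf).isALSW
    have hg' := (hS g hg).isALSW
    have hw : IsALSW (a * (p * b)) := (e₁ ▸ hf').overlap hp (e₂ ▸ hg')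
    have ef : 1 * leadLie f * b = a * p * b := by rw [e₁, one_mul]
    have eg : a * leadLie g * 1 = a * p * b := by rw [e₂, mul_one, mul_assoc]
    rw [← mul_assoc] at hw
    obtain ⟨D, hD⟩ := exists_isSpecialBracketing (a := 1) (b := b) hf' (ef ▸ hw)
    obtain ⟨E, hE⟩ := exists_isSpecialBracketing (a := a) (b := 1) hg' (eg ▸ hw)
    have hp' := length_pos hp
    have h₁ := (h f hf g hg (a * p * b) _ (Or.inr ⟨a, b, D, E, by rw [e₁], by rw [e₂, mul_assoc],
      by rw [e₁, e₂]; simp only [FreeMonoid.length_mul]; omega, hD, hE, rfl⟩)).mem_assocSpanLT hS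
    have h₂ := hD.eval_sub_mem (hS f hf) (Set.mem_image_of_mem (toAssoc k X) hf)
    have h₃ := hE.eval_sub_mem (hS g hg) (Set.mem_image_of_mem (toAssoc k X) hg)
    rw [ef, map_one, one_mul] at h₂
    rw [eg, map_one, mul_one] at h₃
    have h₄ := add_mem (sub_mem h₁ h₂) h₃
    change (D.eval f : MonoidAlgebra k (FreeMonoid X)) - E.eval g - _ + _ ∈ _ at h₄
    have e : ∀ x y z t : MonoidAlgebra k (FreeMonoid X), x - y - (x - z) + (y - t) = z - t :=
      fun _ _ _ _ => by abel
    rwa [e] at h₄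

theorem IsGSBasis.containsLead {S : Set (LieX k X)}
    (hS : ∀ s ∈ S, IsMonic (s : MonoidAlgebra k (FreeMonoid X))) (h : IsGSBasis S)
    {f : LieX k X} (hf : f ∈ lieIdeal S) (hf₀ : f ≠ 0) : ContainsLead S (leadLie f) := by
  obtain ⟨_, ⟨s, hs, rfl⟩, a, b, e⟩ := (h.isAssocGSBasis hS).exists_lead_eq
    (mem_assocSpan_of_mem_lieIdeal hf) (fun h' => hf₀ (Subtype.ext h'))
  exact ⟨s, hs, a, b, e⟩

end Comparison

/-! ### Reduction modulo the ideal -/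

section Reduction

variable {k X : Type*} [Field k]

theorem Ctx.eval_mem_lieIdeal {S : Set (LieX k X)} {s : LieX k X} (hs : s ∈ S) (C : Ctx X) :
    C.eval s ∈ lieIdeal S := by
  induction C with
  | hole => exact LieSubmodule.subset_lieSpan hs
  | mulRight C t ih =>
    change ⁅C.eval s, _⁆ ∈ _
    rw [← lie_skew]
    exact neg_mem (LieSubmodule.lie_mem _ ih)
  | mulLeft t C ih => exact LieSubmodule.lie_mem _ ih

/-- The projection of `Lie(X)` onto `Lie(X|S)` as a linear map. -/
noncomputable abbrev mkIdeal (S : Set (LieX k X)) : LieX k X →ₗ[k] LieX k X ⧸ lieIdeal S :=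
  (lieIdeal S).toSubmodule.mkQ

variable [LinearOrder X]

theorem linearIndependent_monomialClass {S : Set (LieX k X)}
    (h : ∀ f ∈ lieIdeal S, f ≠ 0 → ContainsLead S (leadLie f)) :
    LinearIndependent k (fun t : Irr S => monomialClass S (t : FreeMagma X)) := by
  refine linearIndependent_iff.2 fun l hl => by_contra fun hl₀ => ?_
  set c : FreeMagma X →₀ k := l.embDomain (Function.Embedding.subtype _) with hc
  have hc₀ : c ≠ 0 := fun h' => hl₀ (Finsupp.embDomain_eq_zero.1 h')
  have hIrr : ∀ t ∈ c.support, t ∈ Irr S := by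
    intro t ht
    rw [hc, Finsupp.support_embDomain, Finset.mem_map] at ht
    obtain ⟨t, -, rfl⟩ := ht
    exact t.2
  obtain ⟨t, ht, hlead⟩ := exists_isLeadingWord_linearCombination hc₀ fun t ht => (hIrr t ht).1
  have hmem : Finsupp.linearCombination k (monomial k) c ∈ lieIdeal S := by
    refine (Submodule.Quotient.mk_eq_zero (lieIdeal S).toSubmodule).1 ?_
    change mkIdeal S _ = 0
    rw [hc, Finsupp.linearCombination_embDomain, Finsupp.apply_linearCombination]
    exact hl
  refine (hIrr t ht).2 ?_
  have := h _ hmem fun h' => hlead.ne_zero (by rw [h']; rfl)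
  rwa [leadLie, hlead.lead_eq] at this

variable [WellFoundedLT X]

/-- If the leading word `a s̄ b` of a Lie polynomial contains the leading word of `s`, then the
special bracketing gives a normal word with this leading word. -/
theorem exists_monicAt_eval {S : Set (LieX k X)}
    (hS : ∀ s ∈ S, IsMonic (s : MonoidAlgebra k (FreeMonoid X))) {v : FreeMonoid X}
    (hv : IsALSW v) (hc : ContainsLead S v) :
    ∃ s ∈ S, ∃ D : Ctx X, D.left * leadLie s * D.right = v ∧
      MonicAt (D.eval s : MonoidAlgebra k (FreeMonoid X)) v := by
  obtain ⟨s, hs, a, b, rfl⟩ := hc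
  have hm := hS s hs
  obtain ⟨D, hD⟩ := exists_isSpecialBracketing hm.isALSW hv
  exact ⟨s, hs, D, by rw [hD.left_eq, hD.right_eq], hD.monicAt_eval hm.isALSW.1 hm.monicAt⟩

/-- Reduction: if for every non-zero `f ∈ M` with leading word smaller than `w` there is a monic
`g ∈ M ∩ N` with the same leading word, then `N` contains all `f ∈ M` whose words are smaller than
`w`. -/
theorem mem_of_forall_exists_monicAt {M N : Submodule k (LieX k X)} {w : FreeMonoid X}
    (h : ∀ f ∈ M, f ≠ 0 → DegLexLT (leadLie f) w →
      ∃ g ∈ M, g ∈ N ∧ MonicAt (g : MonoidAlgebra k (FreeMonoid X)) (leadLie f))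
    {f : LieX k X} (hf : f ∈ M) (hw : (f : MonoidAlgebra k (FreeMonoid X)) ∈ wordsLT k w) :
    f ∈ N := by
  have key : ∀ v, ∀ f ∈ M, f ≠ 0 → leadLie f = v → DegLexLT v w → f ∈ N := by
    intro v
    induction v using (DegLexLT.wellFounded (X := X)).induction with
    | _ v ih =>
      rintro f hf hf₀ rfl hlt
      obtain ⟨g, hgM, hgN, hg⟩ := h f hf hf₀ hlt
      have hl := isLeadingWord_lead (f := (f : MonoidAlgebra k (FreeMonoid X)))
        fun h' => hf₀ (Subtype.ext h')
      set c := (f : MonoidAlgebra k (FreeMonoid X)).coeff (leadLie f) with hc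
      have hrest : ((f - c • g : LieX k X) : MonoidAlgebra k (FreeMonoid X)) ∈
          wordsLT k (leadLie f) := by
        change (f : MonoidAlgebra k (FreeMonoid X)) - c • (g : MonoidAlgebra k (FreeMonoid X)) ∈ _
        refine mem_wordsLT_of_coeff_eq_zero
          (Submodule.sub_mem _ hl.2 (Submodule.smul_mem _ _ hg.mem_wordsLE)) ?_
        rw [MonoidAlgebra.coeff_sub, Finsupp.sub_apply, MonoidAlgebra.coeff_smul_apply, hg.coeff,
          smul_eq_mul, mul_one, sub_self]
      rw [← sub_add_cancel f (c • g)]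
      refine add_mem ?_ (Submodule.smul_mem _ _ hgN)
      rcases eq_or_ne (f - c • g) 0 with h₀ | h₀
      · rw [h₀]
        exact zero_mem _
      · have hlt' : DegLexLT (leadLie (f - c • g)) (leadLie f) :=
          hrest _ (isLeadingWord_lead fun h' => h₀ (Subtype.ext h')).1
        exact ih _ hlt' _ (sub_mem hf (Submodule.smul_mem _ _ hgM)) h₀ rfl (hlt'.trans hlt)
  rcases eq_or_ne f 0 with rfl | hf₀
  · exact zero_mem _
  · exact key _ f hf hf₀ rfl (hw _ (isLeadingWord_lead fun h' => hf₀ (Subtype.ext h')).1)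

theorem isTrivialMod_of_mem_lieIdeal {S : Set (LieX k X)}
    (hS : ∀ s ∈ S, IsMonic (s : MonoidAlgebra k (FreeMonoid X)))
    (h : ∀ f ∈ lieIdeal S, f ≠ 0 → ContainsLead S (leadLie f)) {w : FreeMonoid X} {f : LieX k X}
    (hf : f ∈ lieIdeal S) (hw : (f : MonoidAlgebra k (FreeMonoid X)) ∈ wordsLT k w) :
    IsTrivialMod S w f := by
  refine mem_of_forall_exists_monicAt (M := (lieIdeal S).toSubmodule) (fun g hg hg₀ hlt => ?_) hf hw
  obtain ⟨s, hs, D, e, hD⟩ := exists_monicAt_eval hS (isALSW_lead hg₀) (h g hg hg₀)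
  refine ⟨D.eval s, D.eval_mem_lieIdeal hs, Submodule.subset_span ⟨s, hs, D, ?_, ?_, rfl⟩, hD⟩
  · rw [IsNormal, e]
    exact hD.isLeadingWord
  · rwa [e]

theorem isGSBasis_of_forall_containsLead {S : Set (LieX k X)}
    (hS : ∀ s ∈ S, IsMonic (s : MonoidAlgebra k (FreeMonoid X)))
    (h : ∀ f ∈ lieIdeal S, f ≠ 0 → ContainsLead S (leadLie f)) : IsGSBasis S := by
  rintro f hf g hg w _ (⟨a, b, D, e₁, e₂, hD, rfl⟩ | ⟨a, b, D, E, e₁, e₂, -, hD, hE, rfl⟩)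
  · refine isTrivialMod_of_mem_lieIdeal hS h
      (sub_mem (LieSubmodule.subset_lieSpan hf) (D.eval_mem_lieIdeal hg)) ?_
    have h₁ := (hS f hf).monicAt
    have h₂ := hD.monicAt_eval (hS g hg).isALSW.1 (hS g hg).monicAt
    rw [← e₂] at h₂
    change MonicAt _ (leadLie f) at h₁
    rw [← e₁] at h₁
    exact h₁.sub_mem h₂
  · refine isTrivialMod_of_mem_lieIdeal hS h
      (sub_mem (D.eval_mem_lieIdeal hf) (E.eval_mem_lieIdeal hg)) ?_
    have h₁ := hD.monicAt_eval (hS f hf).isALSW.1 (hS f hf).monicAt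
    have h₂ := hE.monicAt_eval (hS g hg).isALSW.1 (hS g hg).monicAt
    rw [one_mul, ← e₁] at h₁
    rw [mul_one, ← e₂] at h₂
    exact h₁.sub_mem h₂

/-- Every Lie polynomial whose words are smaller than `w` is, modulo `Id(S)`, a combination of
elements of `Irr(S)` with words smaller than `w`. -/
theorem mem_lieIdeal_sup_span_irr {S : Set (LieX k X)}
    (hS : ∀ s ∈ S, IsMonic (s : MonoidAlgebra k (FreeMonoid X))) {w : FreeMonoid X} {f : LieX k X}
    (hw : (f : MonoidAlgebra k (FreeMonoid X)) ∈ wordsLT k w) :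
    f ∈ (lieIdeal S).toSubmodule ⊔
      Submodule.span k (monomial k '' {t | t ∈ Irr S ∧ DegLexLT (word t) w}) := by
  refine mem_of_forall_exists_monicAt (M := ⊤) (fun g _ hg₀ hlt => ?_) trivial hw
  have hg := isALSW_lead hg₀
  by_cases hc : ContainsLead S (leadLie g)
  · obtain ⟨s, hs, D, -, hD⟩ := exists_monicAt_eval hS hg hc
    exact ⟨D.eval s, trivial, Submodule.mem_sup_left (D.eval_mem_lieIdeal hs), hD⟩
  · obtain ⟨t, ht, e⟩ := hg.exists_isNLSW
    refine ⟨monomial k t, trivial, Submodule.mem_sup_right (Submodule.subset_span ⟨t, ?_, rfl⟩),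
      e ▸ ht.monicAt⟩
    rw [← e] at hc hlt
    exact ⟨⟨ht, hc⟩, hlt⟩

theorem span_monomialClass_eq_top {S : Set (LieX k X)}
    (hS : ∀ s ∈ S, IsMonic (s : MonoidAlgebra k (FreeMonoid X))) :
    Submodule.span k (Set.range fun t : Irr S => monomialClass S (t : FreeMagma X)) = ⊤ := by
  refine eq_top_iff.2 fun x _ => ?_
  obtain ⟨f, rfl⟩ := Submodule.mkQ_surjective (lieIdeal S).toSubmodule x
  rcases eq_or_ne f 0 with rfl | hf₀
  · rw [map_zero]
    exact zero_mem _
  have hl := isLeadingWord_lead (f := (f : MonoidAlgebra k (FreeMonoid X)))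
    fun h' => hf₀ (Subtype.ext h')
  -- The word `f̄ f̄` serves as a strict upper bound for the words of `f`.
  have hlt : DegLexLT (leadLie f) (leadLie f * leadLie f) := by
    have := length_pos (isALSW_lead hf₀).1
    exact Or.inl (by rw [FreeMonoid.length_mul]; omega)
  obtain ⟨i, hi, y, hy, e⟩ := Submodule.mem_sup.1
    (mem_lieIdeal_sup_span_irr hS (supportedIn_mono (fun v hv => DegLexLE.trans_lt hv hlt) hl.2))
  have h₀ : mkIdeal S i = 0 := (Submodule.Quotient.mk_eq_zero _).2 hi
  have h₁ : mkIdeal S f = mkIdeal S y := by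
    rw [← e, map_add, h₀, zero_add]
  have h₂ : mkIdeal S y ∈ _ := Submodule.mem_map_of_mem hy
  rw [Submodule.map_span, ← Set.image_comp] at h₂
  change mkIdeal S f ∈ _
  rw [h₁]
  refine Submodule.span_mono ?_ h₂
  rintro _ ⟨t, ht, rfl⟩
  exact ⟨⟨t, ht.1⟩, rfl⟩

theorem containsLead_of_linearIndependent {S : Set (LieX k X)}
    (hS : ∀ s ∈ S, IsMonic (s : MonoidAlgebra k (FreeMonoid X)))
    (h : LinearIndependent k (fun t : Irr S => monomialClass S (t : FreeMagma X)))
    {f : LieX k X} (hf : f ∈ lieIdeal S) (hf₀ : f ≠ 0) : ContainsLead S (leadLie f) := by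
  by_contra hno
  have hl := isLeadingWord_lead (f := (f : MonoidAlgebra k (FreeMonoid X)))
    fun h' => hf₀ (Subtype.ext h')
  obtain ⟨t, ht, e⟩ := (isALSW_lead hf₀).exists_isNLSW
  have htI : t ∈ Irr S := ⟨ht, e ▸ hno⟩
  have hm := ht.monicAt (k := k)
  rw [e] at hm
  -- The polynomial `[f̄] - c⁻¹ f` has smaller words, and `[f̄]` is congruent to it.
  set c := (f : MonoidAlgebra k (FreeMonoid X)).coeff (leadLie f) with hc
  have hrest : ((monomial k t - c⁻¹ • f : LieX k X) : MonoidAlgebra k (FreeMonoid X)) ∈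
      wordsLT k (leadLie f) := by
    change (monomial k t : MonoidAlgebra k (FreeMonoid X)) -
      c⁻¹ • (f : MonoidAlgebra k (FreeMonoid X)) ∈ _
    refine mem_wordsLT_of_coeff_eq_zero
      (Submodule.sub_mem _ hm.mem_wordsLE (Submodule.smul_mem _ _ hl.2)) ?_
    rw [MonoidAlgebra.coeff_sub, Finsupp.sub_apply, MonoidAlgebra.coeff_smul_apply, hm.coeff,
      smul_eq_mul, ← hc, inv_mul_cancel₀ hl.1, sub_self]
  obtain ⟨i, hi, y, hy, e'⟩ := Submodule.mem_sup.1 (mem_lieIdeal_sup_span_irr hS hrest)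
  have h₁ : mkIdeal S (monomial k t) = mkIdeal S y := by
    refine (Submodule.Quotient.eq _).2 ?_
    have : monomial k t - y = i + c⁻¹ • f := by
      rw [eq_sub_iff_add_eq.2 (e' : i + y = _)]
      abel
    rw [this]
    exact add_mem hi (Submodule.smul_mem _ _ hf)
  have h₂ : mkIdeal S y ∈ _ := Submodule.mem_map_of_mem hy
  rw [Submodule.map_span, ← Set.image_comp, ← h₁] at h₂
  refine h.notMem_span_image (s := {r | DegLexLT (word r.1) (leadLie f)}) (x := ⟨t, htI⟩)
    (fun h' : DegLexLT (word t) (leadLie f) => DegLexLT.irrefl _ (e ▸ h')) ?_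
  refine Submodule.span_mono ?_ h₂
  rintro _ ⟨r, hr, rfl⟩
  exact ⟨⟨r, hr.1⟩, hr.2, rfl⟩

end Reduction

end LieGS

theorem theorem4p11 {k X : Type*} [Field k] [LinearOrder X] [WellFoundedLT X]
    (S : Set (LieGS.LieX k X))
    (hS : ∀ s ∈ S, LieGS.IsMonic (s : MonoidAlgebra k (FreeMonoid X))) :
    List.TFAE
      [LieGS.IsGSBasis S,
       ∀ f ∈ LieGS.lieIdeal S, f ≠ 0 → LieGS.ContainsLead S (LieGS.leadLie f),
       LinearIndependent k (fun t : LieGS.Irr S => LieGS.monomialClass S (t : FreeMagma X)) ∧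
         Submodule.span k
           (Set.range fun t : LieGS.Irr S => LieGS.monomialClass S (t : FreeMagma X)) = ⊤] := by
  tfae_have 1 → 2 := fun h f hf hf₀ => h.containsLead hS hf hf₀
  tfae_have 2 → 1 := LieGS.isGSBasis_of_forall_containsLead hS
  tfae_have 2 → 3 := fun h =>
    ⟨LieGS.linearIndependent_monomialClass h, LieGS.span_monomialClass_eq_top hS⟩
  tfae_have 3 → 2 := fun h f hf hf₀ => LieGS.containsLead_of_linearIndependent hS h.1 hf hf₀
  tfae_finish
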